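/- **Setting.** Let $p$ be a prime, $\mathbb F=\mathbb Z/p$, $\mathbb G=\mathbb Z/p^2$, and let $\mathscr A$ be the mod $p$ Steenrod algebra with its standard generating set $E_{\mathscr A}$ ($\{Sq^n\}_{n\ge1}$ for $p=2$; $\{P^n\}_{n\ge1}\cup\{\beta P^n\}_{n\ge0}$ for odd $p$). Let $\mathscr B=(\partial:\mathscr B_1\to\mathscr B_0)$ be the pair algebra of secondary cohomology operations; only the following structure is used, and the result holds for every $\mathscr B$ that has it. $\mathscr B_0=T_{\mathbb G}(E_{\mathscr A})$ is the free graded associative algebra; $\mathscr B_1$ is a nonnegatively graded $\mathscr B_0$-bimodule; $\partial$ is a degree preserving bimodule map with $\partial(x)y=x\,\partial(y)$ for $x,y\in\mathscr B_1$; the cokernel of $\partial$ is the canonical $q:\mathscr B_0\to\mathscr A$; there is an isomorphism $\ker\partial\cong\Sigma\mathscr A$ of graded $\mathscr A$-bimodules, where $(\Sigma X)^n=X^{n-1}$, $a\cdot\Sigma x=(-1)^{|a|}\Sigma(ax)$ and $\Sigma x\cdot a=\Sigma(xa)$; and, $[p]\in\mathscr B_1$ being the element of degree $0$ with $\partial[p]=p$,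 one has $e[p]-[p]e=\kappa(e)$ for $e\in E_{\mathscr A}$, where $\kappa(Sq^n)=\Sigma Sq^{n-1}$, $\kappa(P^n)=0$, $\kappa(\beta P^n)=\Sigma P^n$. Put $R_{\mathscr B}=\ker q$ and let $u:R_{\mathscr B}\to\mathscr B_1$ be a degree preserving, right $\mathscr B_0$-equivariant additive splitting of $\partial$, so that $\mathscr B_1=u(R_{\mathscr B})\oplus\Sigma\mathscr A$. The multiplication map $A:\mathscr A\otimes R_{\mathscr B}\to\Sigma\mathscr A$ is $A(q(b),r)=b\,u(r)-u(br)$. The $\mathscr B$-module $\mathbb G^\Sigma$ is $(\mathbb F\oplus\Sigma\mathbb F\to\mathbb G)$, $(x,\Sigma y)\mapsto px$, on which $\mathscr B$ acts through the augmentation $\mathscr B\to\mathbb G^\Sigma$ given by $b\mapsto\varepsilon(b)$ on $\mathscr B_0$ and $u(r)+\Sigma a\mapsto(\varepsilon(r)/p,\Sigma\varepsilon(a))$ on $\mathscr B_1$. Let $$\mathbb F\xleftarrow{\ \varepsilon\ }\mathscr A\langle g_0\rangle\xleftarrow{\ d\ }\mathscr A\langle g_1\rangle\xleftarrow{\ d\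 }\mathscr A\langle g_2\rangle\leftarrow\cdots$$ be a minimal resolution by free graded left $\mathscr A$-modules, where $g_m$ stands for a graded set of generators and $g_0$ is one generator of degree $0$. Lift the matrices of the differentials $d$ to homogeneous matrices over $\mathscr B_0$; with $g_0\mapsto1\in\mathbb G$ they give a sequence of $\mathscr B$-module homomorphisms between the free $\mathscr B$-modules on the same generators and $\mathbb G^\Sigma$, $$\mathbb G^\Sigma\leftarrow\mathscr B\langle g_0\rangle\leftarrow\mathscr B\langle g_1\rangle\leftarrow\mathscr B\langle g_2\rangle\leftarrow\cdots.\qquad(*)$$ Write $(*)$ as $M_0\xleftarrow{d}M_1\xleftarrow{d}\cdots$ with $M_n=(\partial:M_{n,1}\to M_{n,0})$ and $M_n=0$ for $n<0$. A *completion* of $(*)$ to a secondary complex is a family of degree preserving $\mathscr B_0$-linear maps $H_n:M_{n+2,0}\to M_{n,1}$ with $\partial H=dd$, $H\partial=dd$ and $Hd=dH$. It is *exact* if whenever $c\in M_{n,0}$, $\gamma\in M_{n-1,1}$ satisfy $dc=\partial\gamma$ and $Hc=d\gamma$, there are $b\in M_{n+1,0}$, $\beta\in M_{n,1}$ with $c=db+\partial\beta$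 and $\gamma=Hb+d\beta$. **Theorem.** Fix any degree preserving $\mathscr B_0$-linear map $\eta:\mathscr B_0\langle g_1\rangle\to\mathbb F\oplus\Sigma\mathbb F$ (for example $\eta=0$). 1. The completions of $(*)$ to an exact secondary complex with $H_0=\eta$ are in bijection with the families of degree preserving additive maps $\delta_m:\mathscr A\langle g_{m+2}\rangle\to\Sigma\mathscr A\langle g_m\rangle$, $m\ge0$, which satisfy $$\delta(ag)=a\,\delta(g)+A(a,ddg)\quad\text{and}\quad d\,\delta g=\delta\,dg$$ for homogeneous $a\in\mathscr A$ and all generators $g$ (in the relevant degrees), where $ddg$ is computed with the lifted matrices and $A(a,rh):=A(a,r)h$ for $r\in R_{\mathscr B}$ and a generator $h$. The completion corresponding to $\delta$ is $H_{m+1}(x)=u(ddx)+\delta_m(q(x))$, with $u$ and $q$ applied to coefficients. 2. Any choice of values $\delta_m(g)\in\Sigma\mathscr A\langle g_m\rangle$ of degree $|g|$, for the generators $g$ of $\mathscr A\langle g_{m+2}\rangle$, extends uniquely to a family of degree preserving additive maps with $\delta(ag)=a\,\delta(g)+A(a,ddg)$. For a family $\delta$ as in 1, $d\delta=\delta d$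 holds on all elements. 3. For each completion with $H_0=\eta$ there is a unique $\delta$ as in 1 with $H_{m+1}(x)=u(ddx)+\delta_m(q(x))$, and the completion is exact if and only if the chain map $\bar\delta:C_{\bullet+2}\to\Sigma C_\bullet$ is a quasi-isomorphism; here $C$ is the augmented resolution, $C_0=\mathbb F$, $C_{m+1}=\mathscr A\langle g_m\rangle$, and $\bar\delta$ is given by the $\delta_m$ and, in the lowest degree, by the map $\mathscr A\langle g_1\rangle\to\Sigma\mathbb F$ induced by $\eta$. The complex $C$ is acyclic, and every completion with $H_0=\eta$ is exact. -/

import Mathlib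

namespace SecondaryResolution

/-! ### Graded abelian groups -/

/-- The suspension of a grading: `(ΣX)ⁿ = Xⁿ⁻¹`. -/
def suspGr {X : Type} [AddCommGroup X] (gr : ℕ → AddSubgroup X) : ℕ → AddSubgroup X
  | 0 => ⊥
  | n + 1 => gr n

/-- `shiftGr gr d n` is the degree `n - d` part of `X` (zero if `n < d`). -/
def shiftGr {X : Type} [AddCommGroup X] (gr : ℕ → AddSubgroup X) (d n : ℕ) : AddSubgroup X :=
  if d ≤ n then gr (n - d) else ⊥

/-- The grading of the direct sum `⨁_{g ∈ ι} X g` of copies of `X`, the copy indexed by `g` being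
shifted by `deg g`: the expression `x g` has degree `|x| + deg g`. -/
def freeGr {X ι : Type} [AddCommGroup X] (gr : ℕ → AddSubgroup X) (deg : ι → ℕ) (n : ℕ) :
    AddSubgroup (ι →₀ X) where
  carrier := {f | ∀ g, f g ∈ shiftGr gr (deg g) n}
  zero_mem' := fun g => (shiftGr gr (deg g) n).zero_mem
  add_mem' := fun hf hf' g => (shiftGr gr (deg g) n).add_mem (hf g) (hf' g)
  neg_mem' := fun hf g => (shiftGr gr (deg g) n).neg_mem (hf g)

theorem isInternal_of_proj {M : Type} [AddCommGroup M] {gr : ℕ → AddSubgroup M}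
    (π : ℕ → M →+ M) (h1 : ∀ m n x, x ∈ gr m → π n x = if m = n then x else 0)
    (h2 : ∀ x, x ∈ ⨆ n, gr n) : DirectSum.IsInternal gr := by
  constructor
  · rw [injective_iff_map_eq_zero]
    intro x hx
    have key : ∀ n, ∀ y : DirectSum ℕ (fun i => gr i),
        π n (DirectSum.coeAddMonoidHom gr y) = (y n : M) := by
      intro n y
      induction y using DirectSum.induction_on with
      | zero => simp
      | of i z =>
        rw [DirectSum.coeAddMonoidHom_of, h1 i n _ z.2]
        split_ifs with h
        · subst h; simp
        · rw [DirectSum.of_eq_of_ne _ _ _ (Ne.symm h)]; simp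
      | add a b ha hb => simp [ha, hb]
    ext n
    have := key n x
    rw [hx, map_zero] at this
    rw [← this]; rfl
  · intro x
    have hx := h2 x
    refine AddSubgroup.iSup_induction gr (C := fun x => ∃ y, DirectSum.coeAddMonoidHom gr y = x)
      hx (fun i z hz => ⟨DirectSum.of (fun i => gr i) i ⟨z, hz⟩, by simp⟩) ⟨0, by simp⟩ ?_
    rintro _ _ ⟨y, rfl⟩ ⟨z, rfl⟩
    exact ⟨y + z, by simp⟩

theorem exists_proj {M : Type} [AddCommGroup M] {gr : ℕ → AddSubgroup M}
    (h : DirectSum.IsInternal gr) :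
    ∃ π : ℕ → M →+ M, (∀ m n x, x ∈ gr m → π n x = if m = n then x else 0) ∧
      (∀ x, x ∈ ⨆ n, gr n) := by
  let e := AddEquiv.ofBijective (DirectSum.coeAddMonoidHom gr) h
  refine ⟨fun n => ((gr n).subtype.comp (DFinsupp.evalAddMonoidHom n)).comp e.symm.toAddMonoidHom,
    ?_, ?_⟩
  · intro m n x hx
    have : e.symm x = DirectSum.of (fun i => gr i) m ⟨x, hx⟩ := by
      rw [AddEquiv.symm_apply_eq]
      exact (DirectSum.coeAddMonoidHom_of gr m ⟨x, hx⟩).symm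
    change ((e.symm x) n : M) = _
    rw [this]
    split_ifs with h'
    · subst h'; simp
    · rw [DirectSum.of_eq_of_ne _ _ _ (Ne.symm h')]; simp
  · intro x
    obtain ⟨y, rfl⟩ := h.2 x
    induction y using DirectSum.induction_on with
    | zero => simp
    | of i z =>
      rw [DirectSum.coeAddMonoidHom_of]
      exact AddSubgroup.mem_iSup_of_mem i z.2
    | add a b ha hb => rw [map_add]; exact add_mem ha hb

theorem freeGr_internal {X ι : Type} [AddCommGroup X] {gr : ℕ → AddSubgroup X}
    (h : DirectSum.IsInternal gr) (deg : ι → ℕ) : DirectSum.IsInternal (freeGr gr deg) := by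
  classical
  obtain ⟨π, h1, h2⟩ := exists_proj h
  have hsingle : ∀ g x k, x ∈ gr k → Finsupp.single g x ∈ freeGr gr deg (k + deg g) := by
    intro g x k hx g'
    by_cases hg : g = g'
    · subst hg; simpa [shiftGr] using hx
    · rw [Finsupp.single_eq_of_ne (Ne.symm hg)]; exact AddSubgroup.zero_mem _
  refine isInternal_of_proj
    (fun n => Finsupp.liftAddHom fun g =>
      (Finsupp.singleAddHom g).comp (if deg g ≤ n then π (n - deg g) else 0)) ?_ ?_
  · intro m n f hf
    have : ∀ g, (if deg g ≤ n then π (n - deg g) else 0) (f g) = if m = n then f g else 0 := by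
      intro g
      have hg := hf g
      unfold shiftGr at hg
      by_cases hm : deg g ≤ m
      · rw [if_pos hm] at hg
        by_cases hn : deg g ≤ n
        · rw [if_pos hn, h1 _ _ _ hg]
          have : (m - deg g = n - deg g) ↔ m = n := by omega
          simp only [this]
        · rw [if_neg hn, if_neg (by omega)]; rfl
      · rw [if_neg hm, AddSubgroup.mem_bot] at hg
        simp [hg]
    rw [Finsupp.liftAddHom_apply]
    change (f.sum fun g x => Finsupp.single g
      ((if deg g ≤ n then π (n - deg g) else 0) x)) = _
    simp only [Finsupp.sum, this]
    split_ifs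
    · exact Finsupp.sum_single f
    · simp
  · intro f
    induction f using Finsupp.induction_linear with
    | zero => exact AddSubgroup.zero_mem _
    | add a b ha hb => exact add_mem ha hb
    | single g x =>
      have hx := h2 x
      refine AddSubgroup.iSup_induction gr
        (C := fun x => Finsupp.single g x ∈ ⨆ n, freeGr gr deg n) hx
        (fun i z hz => AddSubgroup.mem_iSup_of_mem _ (hsingle g z i hz)) ?_ ?_
      · rw [Finsupp.single_zero]; exact AddSubgroup.zero_mem _
      · intro a b ha hb; rw [Finsupp.single_add]; exact add_mem ha hb

/-! ### The Steenrod algebra -/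

/-- The set `E_𝒜` of generators of the mod `p` Steenrod algebra: `Sqⁿ` (`n ≥ 1`) for `p = 2`;
`Pⁿ` (`n ≥ 1`) and `βPⁿ` (`n ≥ 0`, with `βP⁰ = β`) for odd `p`. -/
inductive SteenrodGen (p : ℕ) : Type
  | Sq (hp : p = 2) (n : ℕ) (hn : 0 < n)
  | P (hp : p ≠ 2) (n : ℕ) (hn : 0 < n)
  | bP (hp : p ≠ 2) (n : ℕ)

/-- Degrees: `|Sqⁿ| = n`, `|Pⁿ| = 2n(p-1)`, `|βPⁿ| = 2n(p-1)+1`. -/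
def SteenrodGen.deg {p : ℕ} : SteenrodGen p → ℕ
  | .Sq _ n _ => n
  | .P _ n _ => 2 * n * (p - 1)
  | .bP _ n => 2 * n * (p - 1) + 1

/-- `Sqⁿ` in the free algebra, with `Sq⁰ = 1`. -/
noncomputable def sq (k : Type) [CommRing k] {p : ℕ} (hp : p = 2) (n : ℕ) :
    FreeAlgebra k (SteenrodGen p) :=
  if hn : 0 < n then FreeAlgebra.ι k (.Sq hp n hn) else 1

/-- `Pⁿ` in the free algebra, with `P⁰ = 1`. -/
noncomputable def pw (k : Type) [CommRing k] {p : ℕ} (hp : p ≠ 2) (n : ℕ) :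
    FreeAlgebra k (SteenrodGen p) :=
  if hn : 0 < n then FreeAlgebra.ι k (.P hp n hn) else 1

/-- `βPⁿ` in the free algebra; `βP⁰ = β`. -/
noncomputable def bpw (k : Type) [CommRing k] {p : ℕ} (hp : p ≠ 2) (n : ℕ) :
    FreeAlgebra k (SteenrodGen p) :=
  FreeAlgebra.ι k (.bP hp n)

/-- The Adem relations (together with `β² = 0` and `β · Pⁿ = βPⁿ` for odd `p`). -/
inductive AdemRel (p : ℕ) :
    FreeAlgebra (ZMod p) (SteenrodGen p) → FreeAlgebra (ZMod p) (SteenrodGen p) → Prop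
  | two (hp : p = 2) (a b : ℕ) (ha : 0 < a) (hab : a < 2 * b) :
      AdemRel p (sq (ZMod p) hp a * sq (ZMod p) hp b)
        (∑ k ∈ Finset.range (a / 2 + 1),
          (Nat.choose (b - k - 1) (a - 2 * k) : ZMod p) •
            (sq (ZMod p) hp (a + b - k) * sq (ZMod p) hp k))
  | powpow (hp : p ≠ 2) (a b : ℕ) (ha : 0 < a) (hab : a < p * b) :
      AdemRel p (pw (ZMod p) hp a * pw (ZMod p) hp b)
        (∑ j ∈ Finset.range (a / p + 1),
          ((-1) ^ (a + j) * (Nat.choose ((p - 1) * (b - j) - 1) (a - p * j) : ZMod p)) •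
            (pw (ZMod p) hp (a + b - j) * pw (ZMod p) hp j))
  | powbock (hp : p ≠ 2) (a b : ℕ) (ha : 0 < a) (hab : a ≤ p * b) :
      AdemRel p (pw (ZMod p) hp a * bpw (ZMod p) hp b)
        (∑ j ∈ Finset.range (a / p + 1),
            ((-1) ^ (a + j) * (Nat.choose ((p - 1) * (b - j)) (a - p * j) : ZMod p)) •
              (bpw (ZMod p) hp (a + b - j) * pw (ZMod p) hp j)
          + ∑ j ∈ Finset.range ((a - 1) / p + 1),
            ((-1) ^ (a + j + 1) *
                (Nat.choose ((p - 1) * (b - j) - 1) (a - p * j - 1) : ZMod p)) •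
              (pw (ZMod p) hp (a + b - j) * bpw (ZMod p) hp j))
  | bock (hp : p ≠ 2) : AdemRel p (bpw (ZMod p) hp 0 * bpw (ZMod p) hp 0) 0
  | bockpow (hp : p ≠ 2) (n : ℕ) :
      AdemRel p (bpw (ZMod p) hp 0 * pw (ZMod p) hp n) (bpw (ZMod p) hp n)

/-- The mod `p` Steenrod algebra `𝒜`. -/
abbrev Steenrod (p : ℕ) : Type := RingQuot (AdemRel p)

/-- `ℬ₀ = T_𝔾(E_𝒜)`, the free associative algebra over `𝔾 = ℤ/p²` on `E_𝒜`. -/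
abbrev B0 (p : ℕ) : Type := FreeAlgebra (ZMod (p ^ 2)) (SteenrodGen p)

/-- The class of a generator in `𝒜`. -/
noncomputable def genA {p : ℕ} (e : SteenrodGen p) : Steenrod p :=
  RingQuot.mkAlgHom (ZMod p) (AdemRel p) (FreeAlgebra.ι (ZMod p) e)

/-- A map on generators which respects the Adem relations induces a map on `𝒜`. -/
noncomputable def liftA {p : ℕ} {X : Type} [Ring X] [Algebra (ZMod p) X] (f : SteenrodGen p → X)
    (hf : ∀ x y, AdemRel p x y → FreeAlgebra.lift (ZMod p) f x = FreeAlgebra.lift (ZMod p) f y) :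
    Steenrod p →ₐ[ZMod p] X :=
  RingQuot.liftAlgHom (ZMod p) ⟨FreeAlgebra.lift (ZMod p) f, fun {_ _} h => hf _ _ h⟩

theorem liftA_gen {p : ℕ} {X : Type} [Ring X] [Algebra (ZMod p) X] (f : SteenrodGen p → X)
    (hf : ∀ x y, AdemRel p x y → FreeAlgebra.lift (ZMod p) f x = FreeAlgebra.lift (ZMod p) f y)
    (e : SteenrodGen p) : liftA f hf (genA e) = f e := by
  simp [liftA, genA]

/-- The projection `q : ℬ₀ → 𝒜`, the identity on generators. -/
noncomputable def q (p : ℕ) : B0 p →+* Steenrod p :=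
  letI : Algebra (ZMod (p ^ 2)) (ZMod p) :=
    (ZMod.castHom (dvd_pow_self p two_ne_zero) (ZMod p)).toAlgebra
  (FreeAlgebra.lift (ZMod (p ^ 2)) (genA (p := p)) : B0 p →ₐ[ZMod (p ^ 2)] Steenrod p).toRingHom

theorem q_gen {p : ℕ} (e : SteenrodGen p) : q p (FreeAlgebra.ι _ e) = genA e := by
  let _ : Algebra (ZMod (p ^ 2)) (ZMod p) :=
    (ZMod.castHom (dvd_pow_self p two_ne_zero) (ZMod p)).toAlgebra
  exact FreeAlgebra.lift_ι_apply _ _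

theorem q_scalar {p : ℕ} (c : ZMod (p ^ 2)) : q p (algebraMap _ _ c) =
    algebraMap (ZMod p) (Steenrod p) (ZMod.castHom (dvd_pow_self p two_ne_zero) (ZMod p) c) := by
  let _ : Algebra (ZMod (p ^ 2)) (ZMod p) :=
    (ZMod.castHom (dvd_pow_self p two_ne_zero) (ZMod p)).toAlgebra
  exact AlgHom.commutes _ _

theorem adjoin_genA {p : ℕ} (S : Subring (Steenrod p)) (hs : ∀ e, genA e ∈ S)
    (hc : ∀ c, algebraMap (ZMod p) (Steenrod p) c ∈ S) (a : Steenrod p) : a ∈ S := by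
  obtain ⟨f, rfl⟩ := RingQuot.mkAlgHom_surjective (ZMod p) (AdemRel p) a
  induction f using FreeAlgebra.induction with
  | grade0 r => rw [AlgHom.commutes]; exact hc r
  | grade1 e => exact hs e
  | mul a b ha hb => rw [map_mul]; exact S.mul_mem ha hb
  | add a b ha hb => rw [map_add]; exact S.add_mem ha hb

theorem q_surjective (p : ℕ) : Function.Surjective (q p) := by
  intro a
  refine adjoin_genA (q p).range (fun e => ⟨_, q_gen e⟩) (fun c => ?_) a
  obtain ⟨c', rfl⟩ := ZMod.castHom_surjective (dvd_pow_self p two_ne_zero) c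
  exact ⟨_, q_scalar c'⟩

/-- `R_ℬ = ker q`, a two-sided ideal of `ℬ₀`. -/
noncomputable abbrev RB (p : ℕ) : Ideal (B0 p) := RingHom.ker (q p)

theorem RB_mul_mem {p : ℕ} (r : RB p) (b : B0 p) : (r : B0 p) * b ∈ RB p :=
  (RB p).mul_mem_right b r.2

/-- The degree `n` part of an algebra `X` generated by (the images `f e` of) the elements of `E_𝒜`:
the span of the monomials of degree `n`. -/
def monGr (k : Type) {X : Type} [CommRing k] [Ring X] [Algebra k X] {p : ℕ}
    (f : SteenrodGen p → X) (n : ℕ) : AddSubgroup X :=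
  (Submodule.span k {x | ∃ l : List (SteenrodGen p),
    (l.map SteenrodGen.deg).sum = n ∧ x = (l.map f).prod}).toAddSubgroup

/-- `ℬ₀ⁿ`. -/
noncomputable def B0gr (p : ℕ) : ℕ → AddSubgroup (B0 p) :=
  monGr (ZMod (p ^ 2)) (FreeAlgebra.ι (ZMod (p ^ 2)))

/-- `𝒜ⁿ`. -/
noncomputable def Agr (p : ℕ) : ℕ → AddSubgroup (Steenrod p) := monGr (ZMod p) genA

theorem B0gr_internal (p : ℕ) : DirectSum.IsInternal (B0gr p) := by
  let k := ZMod (p ^ 2)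
  let φ : B0 p →ₐ[k] Polynomial (B0 p) :=
    FreeAlgebra.lift k fun e => Polynomial.monomial e.deg (FreeAlgebra.ι k e)
  have hφ : ∀ l : List (SteenrodGen p), φ (l.map (FreeAlgebra.ι k)).prod =
      Polynomial.monomial (l.map SteenrodGen.deg).sum (l.map (FreeAlgebra.ι k)).prod := by
    intro l
    induction l with
    | nil => simp
    | cons e l ih =>
      have he : φ (FreeAlgebra.ι k e) = Polynomial.monomial e.deg (FreeAlgebra.ι k e) :=
        FreeAlgebra.lift_ι_apply _ _
      rw [List.map_cons, List.prod_cons, map_mul, ih, he, Polynomial.monomial_mul_monomial,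
        List.map_cons, List.sum_cons]
  refine isInternal_of_proj (fun n =>
    ((Polynomial.lcoeff (B0 p) n).toAddMonoidHom).comp φ.toRingHom.toAddMonoidHom) ?_ ?_
  · intro m n x hx
    change (φ x).coeff n = _
    change x ∈ Submodule.span k _ at hx
    induction hx using Submodule.span_induction with
    | mem x hx =>
      obtain ⟨l, rfl, rfl⟩ := hx
      rw [hφ, Polynomial.coeff_monomial]
    | zero => simp
    | add x y _ _ hx hy => rw [map_add, Polynomial.coeff_add, hx, hy]; split_ifs <;> simp
    | smul c x _ hx => rw [map_smul, Polynomial.coeff_smul, hx]; split_ifs <;> simp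
  · intro x
    have hx : x ∈ Submodule.span k
        (Set.range fun l : List (SteenrodGen p) => (l.map (FreeAlgebra.ι k)).prod) := by
      induction x using FreeAlgebra.induction with
      | grade0 r =>
        rw [Algebra.algebraMap_eq_smul_one]
        exact Submodule.smul_mem _ _ (Submodule.subset_span ⟨[], by simp⟩)
      | grade1 e => exact Submodule.subset_span ⟨[e], by simp [k]⟩
      | add a b ha hb => exact Submodule.add_mem _ ha hb
      | mul a b ha hb =>
        have := Submodule.mul_mem_mul ha hb
        rw [Submodule.span_mul_span] at this
        refine Submodule.span_mono ?_ this
        rintro _ ⟨_, ⟨l, rfl⟩, _, ⟨l', rfl⟩, rfl⟩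
        exact ⟨l ++ l', by simp⟩
    have hmem : ∀ n y, y ∈ B0gr p n → y ∈ ⨆ n, B0gr p n :=
      fun n y hy => AddSubgroup.mem_iSup_of_mem n hy
    obtain ⟨c, rfl⟩ := Finsupp.mem_span_range_iff_exists_finsupp.1 hx
    exact AddSubgroup.sum_mem _ fun l _ => hmem (l.map SteenrodGen.deg).sum _
      (Submodule.smul_mem (Submodule.span k _) _ (Submodule.subset_span ⟨l, rfl, rfl⟩))


/-! ### Augmentations -/

section
variable {p : ℕ} {X : Type} [Ring X] [Algebra (ZMod p) X]

/-- An assignment on generators all of whose products and whose values on the generators of degree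
at least two vanish respects the Adem relations. -/
theorem adem_of_sq_zero (f : SteenrodGen p → X) (hmul : ∀ e e', f e * f e' = 0)
    (h2 : ∀ e : SteenrodGen p, 2 ≤ e.deg → f e = 0) [Fact p.Prime] :
    ∀ x y, AdemRel p x y → FreeAlgebra.lift (ZMod p) f x = FreeAlgebra.lift (ZMod p) f y := by
  have hp1 : 2 ≤ p := (Fact.out : p.Prime).two_le
  have hsq : ∀ (hp : p = 2) n, 2 ≤ n → FreeAlgebra.lift (ZMod p) f (sq (ZMod p) hp n) = 0 := by
    intro hp n hn
    rw [sq, dif_pos (by omega), FreeAlgebra.lift_ι_apply]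
    exact h2 _ hn
  have hP : ∀ (hp : p ≠ 2) n, 0 < n → FreeAlgebra.lift (ZMod p) f (pw (ZMod p) hp n) = 0 := by
    intro hp n hn
    rw [pw, dif_pos hn, FreeAlgebra.lift_ι_apply]
    refine h2 _ ?_
    have : 1 ≤ n * (p - 1) := Nat.mul_pos hn (by omega)
    simp only [SteenrodGen.deg, mul_assoc]
    omega
  have hsqsq : ∀ (hp : p = 2) n m, 0 < n → 0 < m →
      FreeAlgebra.lift (ZMod p) f (sq (ZMod p) hp n * sq (ZMod p) hp m) = 0 := by
    intro hp n m hn hm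
    rw [map_mul, sq, sq, dif_pos hn, dif_pos hm, FreeAlgebra.lift_ι_apply,
      FreeAlgebra.lift_ι_apply, hmul]
  have hbP : ∀ (hp : p ≠ 2) n, 0 < n → FreeAlgebra.lift (ZMod p) f (bpw (ZMod p) hp n) = 0 := by
    intro hp n hn
    rw [bpw, FreeAlgebra.lift_ι_apply]
    refine h2 _ ?_
    have : 1 ≤ n * (p - 1) := Nat.mul_pos hn (by omega)
    simp only [SteenrodGen.deg, mul_assoc]
    omega
  intro x y h
  cases h with
  | two hp a b ha hab =>
    rw [hsqsq hp a b ha (by omega), map_sum]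
    refine (Finset.sum_eq_zero fun k hk => ?_).symm
    rw [Finset.mem_range] at hk
    rw [map_smul]
    rcases Nat.eq_zero_or_pos k with rfl | hk0
    · rw [map_mul, hsq hp _ (by omega), zero_mul, smul_zero]
    · rw [hsqsq hp _ _ (by omega) hk0, smul_zero]
  | powpow hp a b ha hab =>
    rw [map_mul, hP hp a ha, zero_mul, map_sum]
    refine (Finset.sum_eq_zero fun j hj => ?_).symm
    rw [Finset.mem_range] at hj
    have hja : j ≤ a := le_trans (Nat.lt_succ_iff.1 hj) (Nat.div_le_self _ _)
    have hb : 0 < b := Nat.pos_of_ne_zero (by rintro rfl; simp at hab)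
    rw [map_smul, map_mul, hP hp _ (by omega), zero_mul, smul_zero]
  | powbock hp a b ha hab =>
    have hb : 0 < b := Nat.pos_of_ne_zero (by rintro rfl; omega)
    rw [map_mul, hP hp a ha, zero_mul, map_add, map_sum, map_sum]
    rw [Finset.sum_eq_zero, Finset.sum_eq_zero, add_zero]
    · intro j hj
      rw [Finset.mem_range] at hj
      have hja : j ≤ a - 1 := le_trans (Nat.lt_succ_iff.1 hj) (Nat.div_le_self _ _)
      rw [map_smul, map_mul, hP hp _ (by omega), zero_mul, smul_zero]
    · intro j hj
      rw [Finset.mem_range] at hj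
      have hja : j ≤ a := le_trans (Nat.lt_succ_iff.1 hj) (Nat.div_le_self _ _)
      rw [map_smul, map_mul, hbP hp _ (by omega), zero_mul, smul_zero]
  | bock hp => rw [map_mul, bpw, FreeAlgebra.lift_ι_apply, hmul, map_zero]
  | bockpow hp n =>
    rcases Nat.eq_zero_or_pos n with rfl | hn
    · simp [pw]
    · rw [map_mul, hP hp n hn, mul_zero, hbP hp n hn]

end

/-- The augmentation `ε : 𝒜 → 𝔽`. -/
noncomputable def augA (p : ℕ) [Fact p.Prime] : Steenrod p →ₐ[ZMod p] ZMod p :=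
  liftA (fun _ => 0) (adem_of_sq_zero _ (fun _ _ => mul_zero _) fun _ _ => rfl)

/-- The augmentation `ε : ℬ₀ → 𝔾`. -/
noncomputable def augB (p : ℕ) : B0 p →ₐ[ZMod (p ^ 2)] ZMod (p ^ 2) :=
  FreeAlgebra.lift (ZMod (p ^ 2)) fun _ => 0

/-- The `𝒜`-module structure of `𝔽 ⊕ Σ𝔽` underlying `𝔾^Σ`: the generator of degree one (`Sq¹`,
resp. `β`) sends `1 ∈ 𝔽` to `Σ1`, everything else of positive degree acts by zero. In other words,
`a (x, Σy) = (ε(a) x, Σ(ε(a) y) + ε(κ(a)) x)` with `κ` the derivation recorded in `kappaGen`. -/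
noncomputable def actF (p : ℕ) [Fact p.Prime] :
    Steenrod p →ₐ[ZMod p] Module.End (ZMod p) (ZMod p × ZMod p) :=
  liftA (fun e => if e.deg = 1 then
      (LinearMap.inr (ZMod p) (ZMod p) (ZMod p)).comp (LinearMap.fst (ZMod p) (ZMod p) (ZMod p))
    else 0)
    (adem_of_sq_zero _
      (fun e e' => by
        split_ifs <;> ext <;> simp)
      (fun e he => if_neg (by omega)))

theorem augA_gen {p : ℕ} [Fact p.Prime] (e : SteenrodGen p) : augA p (genA e) = 0 := liftA_gen _ _ _

theorem augA_q {p : ℕ} [Fact p.Prime] (b : B0 p) :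
    augA p (q p b) = ZMod.castHom (dvd_pow_self p two_ne_zero) (ZMod p) (augB p b) := by
  induction b using FreeAlgebra.induction with
  | grade0 r => rw [q_scalar, AlgHom.commutes, AlgHom.commutes]; rfl
  | grade1 e => rw [q_gen, augA_gen, augB, FreeAlgebra.lift_ι_apply, map_zero]
  | mul a b ha hb => rw [map_mul, map_mul, map_mul, map_mul, ha, hb]
  | add a b ha hb => rw [map_add, map_add, map_add, map_add, ha, hb]

/-- The inclusion `𝔽 → 𝔾`, `x ↦ p x`. -/
noncomputable def incl (p : ℕ) : ZMod p →+ ZMod (p ^ 2) :=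
  ZMod.lift p ⟨zmultiplesHom (ZMod (p ^ 2)) (p : ZMod (p ^ 2)), by
    simp only [zmultiplesHom_apply, natCast_zsmul, nsmul_eq_mul]
    rw [← Nat.cast_mul, ← pow_two]
    exact ZMod.natCast_self _⟩

theorem incl_intCast {p : ℕ} (n : ℤ) : incl p (n : ZMod p) = n * p := by
  simp [incl]

theorem incl_injective (p : ℕ) [Fact p.Prime] : Function.Injective (incl p) := by
  rw [injective_iff_map_eq_zero]
  intro x hx
  obtain ⟨n, rfl⟩ := ZMod.intCast_surjective x
  rw [incl_intCast] at hx
  have h1 : ((n * p : ℤ) : ZMod (p ^ 2)) = 0 := by exact_mod_cast hx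
  rw [ZMod.intCast_zmod_eq_zero_iff_dvd] at h1
  rw [ZMod.intCast_zmod_eq_zero_iff_dvd]
  have hp : (p : ℤ) ≠ 0 := by exact_mod_cast (Fact.out : p.Prime).ne_zero
  push_cast at h1
  rw [pow_two] at h1
  exact Int.dvd_of_mul_dvd_mul_right hp h1

theorem incl_castHom {p : ℕ} (c : ZMod (p ^ 2)) :
    incl p (ZMod.castHom (dvd_pow_self p two_ne_zero) (ZMod p) c) = c * p := by
  obtain ⟨n, rfl⟩ := ZMod.intCast_surjective c
  rw [map_intCast, incl_intCast]

theorem incl_mul {p : ℕ} (x : ZMod p) (c : ZMod (p ^ 2)) :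
    incl p (x * ZMod.castHom (dvd_pow_self p two_ne_zero) (ZMod p) c) = incl p x * c := by
  obtain ⟨n, rfl⟩ := ZMod.intCast_surjective c
  obtain ⟨m, rfl⟩ := ZMod.intCast_surjective x
  rw [map_intCast, ← Int.cast_mul, incl_intCast, incl_intCast]
  push_cast; ring

theorem exists_incl {p : ℕ} [Fact p.Prime] (r : RB p) : ∃ x, incl p x = augB p r := by
  have h := augA_q (r : B0 p)
  rw [show q p r = 0 from r.2, map_zero] at h
  obtain ⟨n, hn⟩ := ZMod.intCast_surjective (augB p r)
  rw [← hn, map_intCast] at h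
  have h' := h.symm
  rw [ZMod.intCast_zmod_eq_zero_iff_dvd] at h'
  obtain ⟨m, rfl⟩ := h'
  refine ⟨(m : ZMod p), ?_⟩
  rw [incl_intCast, ← hn]; push_cast; ring

/-- The map `R_ℬ → 𝔽` sending `r` to `ε(r) / p`. -/
noncomputable def rho (p : ℕ) [Fact p.Prime] : RB p →+ ZMod p where
  toFun r := (exists_incl r).choose
  map_zero' := by
    apply incl_injective p
    rw [(exists_incl (0 : RB p)).choose_spec]; simp
  map_add' r s := by
    apply incl_injective p
    rw [(exists_incl (r + s)).choose_spec, map_add, (exists_incl r).choose_spec,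
      (exists_incl s).choose_spec]
    simp

theorem incl_rho {p : ℕ} [Fact p.Prime] (r : RB p) : incl p (rho p r) = augB p r :=
  (exists_incl r).choose_spec

/-! ### Pair algebras over `ℬ₀` -/

/-- A pair algebra `∂ : B₁ → B₀` over `𝔾` (concentrated in nonnegative degrees) whose degree zero
part `B₀` is the free algebra `ℬ₀`: a graded `B₀`-`B₀`-bimodule `B₁` with a bimodule homomorphism
`∂` of degree zero satisfying `∂(x) y = x ∂(y)`. The right action is written with `MulOpposite`. -/
structure PairAlgebra (p : ℕ) where
  B₁ : Type
  [addCommGroup : AddCommGroup B₁]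
  [leftModule : Module (B0 p) B₁]
  [rightModule : Module (B0 p)ᵐᵒᵖ B₁]
  [bimodule : SMulCommClass (B0 p) (B0 p)ᵐᵒᵖ B₁]
  scalar_comm : ∀ (c : ZMod (p ^ 2)) (x : B₁),
    algebraMap (ZMod (p ^ 2)) (B0 p) c • x =
      MulOpposite.op (algebraMap (ZMod (p ^ 2)) (B0 p) c) • x
  gr : ℕ → AddSubgroup B₁
  internal : DirectSum.IsInternal gr
  smul_mem : ∀ {m n : ℕ} {b : B0 p} {x : B₁}, b ∈ B0gr p m → x ∈ gr n → b • x ∈ gr (m + n)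
  op_smul_mem : ∀ {m n : ℕ} {b : B0 p} {x : B₁}, b ∈ B0gr p m → x ∈ gr n →
    MulOpposite.op b • x ∈ gr (n + m)
  bd : B₁ →ₗ[B0 p] B0 p
  bd_op_smul : ∀ (b : B0 p) (x : B₁), bd (MulOpposite.op b • x) = bd x * b
  bd_mem : ∀ {n : ℕ} {x : B₁}, x ∈ gr n → bd x ∈ B0gr p n
  bd_smul_eq : ∀ x y : B₁, bd x • y = MulOpposite.op (bd y) • x

attribute [instance] PairAlgebra.addCommGroup PairAlgebra.leftModule PairAlgebra.rightModule
  PairAlgebra.bimodule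

/-- The derivation `κ : 𝒜 → Σ𝒜` on generators: `κ(Sqⁿ) = ΣSqⁿ⁻¹`, resp. `κ(Pⁿ) = 0` and
`κ(βPⁿ) = ΣPⁿ` (i.e. `κ(β) = Σ1`). -/
noncomputable def kappaGen {p : ℕ} : SteenrodGen p → Steenrod p
  | .Sq hp n _ => RingQuot.mkAlgHom (ZMod p) (AdemRel p) (sq (ZMod p) hp (n - 1))
  | .P _ _ _ => 0
  | .bP hp n => RingQuot.mkAlgHom (ZMod p) (AdemRel p) (pw (ZMod p) hp n)

/-- A pair algebra `ℬ = (∂ : ℬ₁ → ℬ₀)` of secondary cohomology operations: `ℬ₀ = T_𝔾(E_𝒜)`,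
`π₀ℬ = coker ∂ = 𝒜` via `q`, a `Σ`-structure `π₁ℬ = ker ∂ ≅ Σ𝒜` (an isomorphism of graded
`𝒜`-`𝒜`-bimodules, where `a · Σx = (-1)^{|a|} Σ(ax)` and `Σx · a = Σ(xa)`), such that
`b [p] - [p] b = κ(b)` where `[p] ∈ ℬ₁` is the element of degree zero over `p ∈ ℬ₀`.
Here `sus a` is the element of `ker ∂` which corresponds to `Σa`. -/
structure SecondaryAlgebra (p : ℕ) extends PairAlgebra p where
  exact₀ : ∀ b : B0 p, q p b = 0 ↔ ∃ x, bd x = b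
  sus : Steenrod p →+ B₁
  sus_injective : Function.Injective sus
  exact₁ : ∀ x : B₁, bd x = 0 ↔ ∃ a, sus a = x
  sus_mem : ∀ {n : ℕ} {a : Steenrod p}, a ∈ Agr p n → sus a ∈ gr (n + 1)
  smul_sus : ∀ {n : ℕ} {b : B0 p} (a : Steenrod p), b ∈ B0gr p n →
    b • sus a = (-1 : ℤ) ^ n • sus (q p b * a)
  op_smul_sus : ∀ (b : B0 p) (a : Steenrod p), MulOpposite.op b • sus a = sus (a * q p b)
  kappa : ∀ x ∈ gr 0, bd x = (p : B0 p) → ∀ e : SteenrodGen p,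
    (FreeAlgebra.ι (ZMod (p ^ 2)) e : B0 p) • x -
      MulOpposite.op (FreeAlgebra.ι (ZMod (p ^ 2)) e : B0 p) • x = sus (kappaGen e)

/-- A right `ℬ₀`-equivariant splitting `u : R_ℬ → ℬ₁` of degree zero of the projection
`∂ : ℬ₁ → R_ℬ`. -/
structure Splitting {p : ℕ} (B : SecondaryAlgebra p) where
  u : RB p →+ B.B₁
  bd_u : ∀ r, B.bd (u r) = r
  u_mul : ∀ (r : RB p) (b : B0 p), u ⟨(r : B0 p) * b, RB_mul_mem r b⟩ = MulOpposite.op b • u r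
  u_mem : ∀ {n : ℕ} (r : RB p), (r : B0 p) ∈ B0gr p n → u r ∈ B.gr n

namespace SecondaryAlgebra

variable {p : ℕ} (B : SecondaryAlgebra p)

theorem bd_mem_RB (x : B.B₁) : B.bd x ∈ RB p := (B.exact₀ _).2 ⟨x, rfl⟩

/-- `∂` as a map to `R_ℬ`. -/
noncomputable def bdR : B.B₁ →+ RB p where
  toFun x := ⟨B.bd x, B.bd_mem_RB x⟩
  map_zero' := by ext; simp
  map_add' x y := by ext; simp

/-- The inverse of `sus : 𝒜 → ker ∂`, applied to an element of `ker ∂`. -/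
noncomputable def unsus (x : B.B₁) (hx : B.bd x = 0) : Steenrod p := ((B.exact₁ x).1 hx).choose

theorem sus_unsus (x : B.B₁) (hx : B.bd x = 0) : B.sus (B.unsus x hx) = x :=
  ((B.exact₁ x).1 hx).choose_spec

end SecondaryAlgebra

namespace Splitting

variable {p : ℕ} {B : SecondaryAlgebra p} (s : Splitting B)

theorem bd_smul_sub (b : B0 p) (r : RB p) : B.bd (b • s.u r - s.u (b • r)) = 0 := by
  rw [map_sub, map_smul, s.bd_u, s.bd_u]; simp

/-- The multiplication map `A : 𝒜 ⊗ R_ℬ → Σ𝒜` of `ℬ` (with respect to the splitting `u`):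
`A(q(b), r) = b u(r) - u(b r)`. -/
noncomputable def A (a : Steenrod p) (r : RB p) : Steenrod p :=
  B.unsus _ (s.bd_smul_sub (Function.surjInv (q_surjective p) a) r)

/-- `A(a, r)` does not depend on the choice of the element `b` with `q(b) = a`. -/
theorem sus_A (b : B0 p) (r : RB p) : B.sus (s.A (q p b) r) = b • s.u r - s.u (b • r) := by
  rw [A, B.sus_unsus]
  set b' := Function.surjInv (q_surjective p) (q p b) with hb'
  have h : q p (b - b') = 0 := by
    rw [map_sub, hb', Function.surjInv_eq (q_surjective p), sub_self]
  obtain ⟨c, hc⟩ : ∃ c : RB p, (c : B0 p) = b - b' := ⟨⟨_, h⟩, rfl⟩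
  have h1 : (c : B0 p) • s.u r = s.u ((c : B0 p) • r) := by
    have := s.u_mul c (r : B0 p)
    rw [← s.bd_u r, ← B.bd_smul_eq (s.u c) (s.u r), s.bd_u c] at this
    rw [← this]
    congr 1
    ext
    simp [s.bd_u]
  have h2 : c • r = b • r - b' • r := by
    ext
    simp [hc, sub_mul]
  rw [hc, sub_smul, ← hc] at h1
  change _ = s.u (c • r) at h1
  rw [h2, map_sub] at h1
  rw [← sub_eq_zero] at h1 ⊢
  rw [← neg_eq_zero, ← h1]
  abel

theorem bd_sub_u (x : B.B₁) : B.bd (x - s.u (B.bdR x)) = 0 := by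
  rw [map_sub, s.bd_u]; exact sub_self _

/-- `Σ`-component of `x = u(∂x) + Σa`. -/
noncomputable def sComp : B.B₁ →+ Steenrod p where
  toFun x := B.unsus (x - s.u (B.bdR x)) (s.bd_sub_u x)
  map_zero' := by
    apply B.sus_injective; rw [B.sus_unsus]; simp
  map_add' x y := by
    apply B.sus_injective
    rw [B.sus_unsus, map_add B.sus, B.sus_unsus, B.sus_unsus, map_add, map_add]; abel

theorem sus_sComp (x : B.B₁) : B.sus (s.sComp x) = x - s.u (B.bdR x) :=
  B.sus_unsus _ (s.bd_sub_u x)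

/-- The augmentation `ℬ₁ → 𝔽 ⊕ Σ𝔽`, `u(r) + Σa ↦ (ε(r)/p, Σε(a))`. -/
noncomputable def aug₁ [Fact p.Prime] : B.B₁ →+ ZMod p × ZMod p :=
  ((rho p).comp B.bdR).prod ((augA p : Steenrod p →+* ZMod p).toAddMonoidHom.comp s.sComp)

end Splitting

/-! ### Modules over pair algebras -/

theorem monGr_mul {k X : Type} [CommRing k] [Ring X] [Algebra k X] {p : ℕ}
    {f : SteenrodGen p → X} {m n : ℕ} {x y : X} (hx : x ∈ monGr k f m) (hy : y ∈ monGr k f n) :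
    x * y ∈ monGr k f (m + n) := by
  have := Submodule.mul_mem_mul (show x ∈ Submodule.span k _ from hx)
    (show y ∈ Submodule.span k _ from hy)
  rw [Submodule.span_mul_span] at this
  refine Submodule.span_mono ?_ this
  rintro _ ⟨_, ⟨l, rfl, rfl⟩, _, ⟨l', rfl, rfl⟩, rfl⟩
  exact ⟨l ++ l', by simp, by simp⟩

theorem shiftGr_of_le {X : Type} [AddCommGroup X] (gr : ℕ → AddSubgroup X) (d n : ℕ) :
    shiftGr gr d (n + d) = gr n := by simp [shiftGr]

theorem shiftGr_map {X Y : Type} [AddCommGroup X] [AddCommGroup Y] {gr : ℕ → AddSubgroup X}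
    {gr' : ℕ → AddSubgroup Y} (φ : X →+ Y) (m : ℕ) (h : ∀ n x, x ∈ gr n → φ x ∈ gr' (m + n))
    (d n : ℕ) (x : X) (hx : x ∈ shiftGr gr d n) : φ x ∈ shiftGr gr' d (m + n) := by
  unfold shiftGr at *
  split_ifs at hx with hd
  · rw [if_pos (by omega), Nat.add_sub_assoc hd]
    exact h _ _ hx
  · rw [AddSubgroup.mem_bot] at hx
    subst hx
    rw [map_zero]
    exact zero_mem _

theorem shiftGr_mem {X Y : Type} [AddCommGroup X] [AddCommGroup Y] {gr : ℕ → AddSubgroup X}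
    {gr' : ℕ → AddSubgroup Y} (φ : X →+ Y) (d : ℕ) (h : ∀ n x, x ∈ gr n → φ x ∈ gr' (n + d))
    (n : ℕ) (x : X) (hx : x ∈ shiftGr gr d n) : φ x ∈ gr' n := by
  unfold shiftGr at *
  split_ifs at hx with hd
  · have := h _ _ hx
    rwa [Nat.sub_add_cancel hd] at this
  · rw [AddSubgroup.mem_bot] at hx
    subst hx
    rw [map_zero]
    exact zero_mem _

/-- A (left) module `M = (∂ : M₁ → M₀)` over a pair algebra `B`: a graded pair of left
`B₀`-modules together with `μ̄ : B₁ ⊗_{B₀} M₀ → M₁`, here `act`, such that `∂(μ̄(x ⊗ y)) = ∂(x) y`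
and `μ̄(x ⊗ ∂(y)) = ∂(x) y`. -/
structure PairModule {p : ℕ} (B : PairAlgebra p) where
  M₀ : Type
  M₁ : Type
  [addCommGroup₀ : AddCommGroup M₀]
  [addCommGroup₁ : AddCommGroup M₁]
  [module₀ : Module (B0 p) M₀]
  [module₁ : Module (B0 p) M₁]
  gr₀ : ℕ → AddSubgroup M₀
  gr₁ : ℕ → AddSubgroup M₁
  internal₀ : DirectSum.IsInternal gr₀
  internal₁ : DirectSum.IsInternal gr₁
  smul_mem₀ : ∀ {m n : ℕ} {b : B0 p} {y : M₀}, b ∈ B0gr p m → y ∈ gr₀ n → b • y ∈ gr₀ (m + n)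
  smul_mem₁ : ∀ {m n : ℕ} {b : B0 p} {y : M₁}, b ∈ B0gr p m → y ∈ gr₁ n → b • y ∈ gr₁ (m + n)
  bd : M₁ →ₗ[B0 p] M₀
  bd_mem : ∀ {n : ℕ} {y : M₁}, y ∈ gr₁ n → bd y ∈ gr₀ n
  act : B.B₁ →+ M₀ →+ M₁
  act_mem : ∀ {m n : ℕ} {x : B.B₁} {y : M₀}, x ∈ B.gr m → y ∈ gr₀ n → act x y ∈ gr₁ (m + n)
  smul_act : ∀ (b : B0 p) (x : B.B₁) (y : M₀), act (b • x) y = b • act x y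
  act_smul : ∀ (b : B0 p) (x : B.B₁) (y : M₀), act (MulOpposite.op b • x) y = act x (b • y)
  bd_act : ∀ (x : B.B₁) (y : M₀), bd (act x y) = B.bd x • y
  act_bd : ∀ (x : B.B₁) (y : M₁), act x (bd y) = B.bd x • y

attribute [instance] PairModule.addCommGroup₀ PairModule.addCommGroup₁ PairModule.module₀
  PairModule.module₁

namespace PairModule

variable {p : ℕ} {B : PairAlgebra p}

/-- Morphisms of `B`-modules: `B₀`-linear maps of degree zero compatible with `∂` and `μ̄`. -/
structure Hom (M N : PairModule B) where
  f₀ : M.M₀ →ₗ[B0 p] N.M₀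
  f₁ : M.M₁ →ₗ[B0 p] N.M₁
  f₀_mem : ∀ {n : ℕ} {y : M.M₀}, y ∈ M.gr₀ n → f₀ y ∈ N.gr₀ n
  f₁_mem : ∀ {n : ℕ} {y : M.M₁}, y ∈ M.gr₁ n → f₁ y ∈ N.gr₁ n
  bd_f₁ : ∀ y, N.bd (f₁ y) = f₀ (M.bd y)
  f₁_act : ∀ x y, f₁ (M.act x y) = N.act x (f₀ y)

/-- `b ↦ x b` as a map `ℬ₀ → B₁`. -/
def mulRight (x : B.B₁) : B0 p →+ B.B₁ where
  toFun b := MulOpposite.op b • x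
  map_zero' := by simp
  map_add' b c := by rw [MulOpposite.op_add, add_smul]

/-- The free `B`-module `B[I] = ⨁_{g ∈ I} B[g]` on generators `g` of degree `deg g`, where
`μ̄(x ⊗ b g) = (x b) g`. -/
noncomputable def free (B : PairAlgebra p) {I : Type} (deg : I → ℕ) : PairModule B where
  M₀ := I →₀ B0 p
  M₁ := I →₀ B.B₁
  gr₀ := freeGr (B0gr p) deg
  gr₁ := freeGr B.gr deg
  internal₀ := freeGr_internal (B0gr_internal p) deg
  internal₁ := freeGr_internal B.internal deg
  smul_mem₀ := fun {m n b y} hb hy g =>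
    shiftGr_map (AddMonoidHom.mulLeft b) m (fun _ _ hx => monGr_mul hb hx) _ _ _ (hy g)
  smul_mem₁ := fun {m n b y} hb hy g =>
    shiftGr_map (DistribSMul.toAddMonoidHom _ b) m (fun _ _ hx => B.smul_mem hb hx) _ _ _ (hy g)
  bd := Finsupp.mapRange.linearMap B.bd
  bd_mem := fun {n y} hy g => by
    have := shiftGr_map (gr' := B0gr p) B.bd.toAddMonoidHom 0
      (fun n x hx => by rw [Nat.zero_add]; exact B.bd_mem hx) _ _ _ (hy g)
    rw [Nat.zero_add] at this
    simpa using this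
  act :=
    { toFun := fun x => Finsupp.mapRange.addMonoidHom (mulRight x)
      map_zero' := by ext; simp [mulRight]
      map_add' := fun x y => by ext; simp [mulRight] }
  act_mem := fun {m n x y} hx hy g =>
    shiftGr_map (mulRight x) m (fun _ _ hb => B.op_smul_mem hb hx) _ _ _ (hy g)
  smul_act := fun b x y => by
    ext g
    exact (smul_comm b (MulOpposite.op (y g)) x).symm
  act_smul := fun b x y => by
    ext g
    change MulOpposite.op (y g) • MulOpposite.op b • x = MulOpposite.op (b * y g) • x
    rw [MulOpposite.op_mul, mul_smul]
  bd_act := fun x y => by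
    ext g
    exact B.bd_op_smul _ _
  act_bd := fun x y => by
    ext g
    exact (B.bd_smul_eq x (y g)).symm

/-- The map `x ↦ μ̄(x ⊗ y)`. -/
def actOn (N : PairModule B) (y : N.M₀) : B.B₁ →ₗ[B0 p] N.M₁ where
  toFun x := N.act x y
  map_add' := fun x x' => by rw [map_add]; rfl
  map_smul' := fun b x => N.smul_act b x y

/-- The morphism from a free `B`-module with prescribed values on the generators: it is given by
`b g ↦ b y_g` for `b ∈ B₀` and by `x g ↦ μ̄(x ⊗ y_g)` for `x ∈ B₁`. -/
noncomputable def freeLift {I : Type} (deg : I → ℕ) (N : PairModule B) (y : I → N.M₀)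
    (hy : ∀ g, y g ∈ N.gr₀ (deg g)) : Hom (free B deg) N where
  f₀ := Finsupp.linearCombination (B0 p) y
  f₁ := Finsupp.lsum ℕ fun g => N.actOn (y g)
  f₀_mem := fun {n x} hx => by
    change (x.sum fun g b => b • y g) ∈ _
    exact AddSubgroup.sum_mem _ fun g _ => shiftGr_mem (gr' := N.gr₀)
      ((LinearMap.toSpanSingleton (B0 p) N.M₀ (y g)).toAddMonoidHom) (deg g)
      (fun k b hb => N.smul_mem₀ hb (hy g)) n _ (hx g)
  f₁_mem := fun {n x} hx => by
    change (x.sum fun g b => N.actOn (y g) b) ∈ _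
    exact AddSubgroup.sum_mem _ fun g _ => shiftGr_mem (gr' := N.gr₁)
      (N.actOn (y g)).toAddMonoidHom (deg g)
      (fun k b hb => N.act_mem hb (hy g)) n _ (hx g)
  bd_f₁ := fun x => by
    have : N.bd.comp (Finsupp.lsum ℕ fun g => N.actOn (y g)) =
        (Finsupp.linearCombination (B0 p) y).comp (free B deg).bd := by
      apply Finsupp.lhom_ext
      intro g b
      change N.bd (Finsupp.lsum ℕ (fun g => N.actOn (y g)) (Finsupp.single g b)) =
        Finsupp.linearCombination (B0 p) y (Finsupp.mapRange.linearMap B.bd (Finsupp.single g b))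
      rw [Finsupp.lsum_single, Finsupp.mapRange.linearMap_apply, Finsupp.mapRange_single,
        Finsupp.linearCombination_single]
      exact N.bd_act _ _
    exact LinearMap.congr_fun this x
  f₁_act := fun x z => by
    have : (Finsupp.lsum ℕ fun g => N.actOn (y g)).toAddMonoidHom.comp ((free B deg).act x) =
        (N.act x).comp (Finsupp.linearCombination (B0 p) y).toAddMonoidHom := by
      apply Finsupp.addHom_ext
      intro g b
      change Finsupp.lsum ℕ (fun g => N.actOn (y g))
          (Finsupp.mapRange.addMonoidHom (mulRight x) (Finsupp.single g b)) =
        N.act x (Finsupp.linearCombination (B0 p) y (Finsupp.single g b))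
      rw [Finsupp.mapRange.addMonoidHom_apply, Finsupp.mapRange_single, Finsupp.lsum_single,
        Finsupp.linearCombination_single]
      exact N.act_smul _ _ _
    exact DFunLike.congr_fun this z

end PairModule

/-! ### The module `𝔾^Σ` -/

section
variable {p : ℕ} [Fact p.Prime]

theorem actF_fst (a : Steenrod p) (v : ZMod p × ZMod p) :
    (actF p a v).1 = augA p a * v.1 := by
  obtain ⟨f, rfl⟩ := RingQuot.mkAlgHom_surjective (ZMod p) (AdemRel p) a
  induction f using FreeAlgebra.induction generalizing v with
  | grade0 r => rw [AlgHom.commutes, AlgHom.commutes, AlgHom.commutes]; rfl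
  | grade1 e =>
    change (actF p (genA e) v).1 = augA p (genA e) * v.1
    rw [augA_gen, actF, liftA_gen]
    split_ifs <;> simp
  | mul a b ha hb =>
    rw [map_mul, map_mul, map_mul, Module.End.mul_apply, ha, hb, mul_assoc]
  | add a b ha hb =>
    rw [map_add, map_add, map_add, LinearMap.add_apply, Prod.fst_add, ha, hb, add_mul]

theorem augB_eq_zero {n : ℕ} {b : B0 p} (hb : b ∈ B0gr p (n + 1)) : augB p b = 0 := by
  change b ∈ Submodule.span _ _ at hb
  induction hb using Submodule.span_induction with
  | mem x hx =>
    obtain ⟨l, hl, rfl⟩ := hx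
    cases l with
    | nil => simp at hl
    | cons e l => simp [augB]
  | zero => simp
  | add x y _ _ hx hy => rw [map_add, hx, hy, add_zero]
  | smul c x _ hx => rw [map_smul, hx, smul_zero]

theorem deg_pos (e : SteenrodGen p) : 0 < e.deg := by
  have hp1 : 2 ≤ p := (Fact.out : p.Prime).two_le
  cases e with
  | Sq _ n hn => exact hn
  | P _ n hn => exact Nat.mul_pos (by omega) (by omega)
  | bP _ n => exact Nat.succ_pos _

theorem B0gr_zero {b : B0 p} (hb : b ∈ B0gr p 0) : b = algebraMap _ _ (augB p b) := by
  change b ∈ Submodule.span _ _ at hb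
  induction hb using Submodule.span_induction with
  | mem x hx =>
    obtain ⟨l, hl, rfl⟩ := hx
    cases l with
    | nil => simp
    | cons e l => have := deg_pos e; simp at hl; omega
  | zero => simp
  | add x y _ _ hx hy => rw [map_add, map_add, ← hx, ← hy]
  | smul c x _ hx => rw [map_smul, smul_eq_mul, map_mul, ← hx, Algebra.smul_def]

theorem augA_eq_zero {n : ℕ} {a : Steenrod p} (ha : a ∈ Agr p (n + 1)) : augA p a = 0 := by
  change a ∈ Submodule.span _ _ at ha
  induction ha using Submodule.span_induction with
  | mem x hx =>
    obtain ⟨l, hl, rfl⟩ := hx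
    cases l with
    | nil => simp at hl
    | cons e l => rw [List.map_cons, List.prod_cons, map_mul, augA_gen, zero_mul]
  | zero => simp
  | add x y _ _ hx hy => rw [map_add, hx, hy, add_zero]
  | smul c x _ hx => rw [map_smul, hx, smul_zero]

theorem mem_iSup_Agr (a : Steenrod p) : a ∈ ⨆ n, Agr p n := by
  obtain ⟨b, rfl⟩ := q_surjective p a
  obtain ⟨_, _, h2⟩ := exists_proj (B0gr_internal p)
  have hq : ∀ n (b : B0 p), b ∈ B0gr p n → q p b ∈ Agr p n := by
    intro n b hb
    change b ∈ Submodule.span _ _ at hb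
    induction hb using Submodule.span_induction with
    | mem x hx =>
      obtain ⟨l, hl, rfl⟩ := hx
      refine Submodule.subset_span ⟨l, hl, ?_⟩
      rw [map_list_prod, List.map_map]
      congr 1
      exact List.map_congr_left fun e _ => q_gen e
    | zero => rw [map_zero]; exact zero_mem _
    | add x y _ _ hx hy => rw [map_add]; exact add_mem hx hy
    | smul c x _ hx =>
      rw [Algebra.smul_def, map_mul, q_scalar, ← Algebra.smul_def]
      exact Submodule.smul_mem (Submodule.span _ _) _ hx
  refine AddSubgroup.iSup_induction (B0gr p) (C := fun b => q p b ∈ ⨆ n, Agr p n) (h2 b)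
    (fun i b hb => AddSubgroup.mem_iSup_of_mem i (hq i b hb)) ?_ ?_
  · rw [map_zero]; exact zero_mem _
  · intro x y hx hy; rw [map_add]; exact add_mem hx hy

variable {B : SecondaryAlgebra p} (s : Splitting B)

/-- An element of `Σ𝒜` which is homogeneous of degree different from one has trivial image in
`Σ𝔽`. -/
theorem augA_eq_zero_of_sus_mem {m : ℕ} {a : Steenrod p} (ha : B.sus a ∈ B.gr m) (hm : m ≠ 1) :
    augA p a = 0 := by
  obtain ⟨π, h1, h2⟩ := exists_proj B.internal
  have key : ∀ a : Steenrod p,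
      π 1 (B.sus a) = B.sus (algebraMap (ZMod p) (Steenrod p) (augA p a)) := by
    intro a
    refine AddSubgroup.iSup_induction (Agr p) (C := fun a => π 1 (B.sus a) =
      B.sus (algebraMap (ZMod p) (Steenrod p) (augA p a))) (mem_iSup_Agr a) ?_ ?_ ?_
    · intro i a ha
      rw [h1 _ 1 _ (B.sus_mem ha)]
      rcases i with _ | i
      · rw [if_pos rfl]
        congr 1
        change a ∈ Submodule.span _ _ at ha
        induction ha using Submodule.span_induction with
        | mem x hx =>
          obtain ⟨l, hl, rfl⟩ := hx
          cases l with
          | nil => simp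
          | cons e l => have := deg_pos e; simp at hl; omega
        | zero => simp
        | add x y _ _ hx hy => rw [map_add, map_add, ← hx, ← hy]
        | smul c x _ hx => rw [map_smul, smul_eq_mul, map_mul, ← hx, Algebra.smul_def]
      · rw [if_neg (by omega), augA_eq_zero ha, map_zero, map_zero]
    · simp
    · intro x y hx hy; simp only [map_add, hx, hy]
  have h := key a
  rw [h1 _ 1 _ ha, if_neg hm] at h
  have h' : algebraMap (ZMod p) (Steenrod p) (augA p a) = 0 := B.sus_injective (by rw [← h, map_zero])
  have := congrArg (augA p) h'
  rwa [AlgHom.commutes, map_zero] at this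

namespace Splitting

theorem aug₁_fst (x : B.B₁) : (s.aug₁ x).1 = rho p (B.bdR x) := rfl

theorem aug₁_snd (x : B.B₁) : (s.aug₁ x).2 = augA p (s.sComp x) := rfl

theorem sus_sComp_mem {n : ℕ} {x : B.B₁} (hx : x ∈ B.gr n) : B.sus (s.sComp x) ∈ B.gr n := by
  rw [s.sus_sComp]
  exact sub_mem hx (s.u_mem _ (B.bd_mem hx))

theorem rho_eq_zero {n : ℕ} {x : B.B₁} (hx : x ∈ B.gr (n + 1)) : rho p (B.bdR x) = 0 := by
  apply incl_injective p
  rw [incl_rho, map_zero]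
  exact augB_eq_zero (B.bd_mem hx)

theorem aug₁_op_smul (b : B0 p) (x : B.B₁) : s.aug₁ (MulOpposite.op b • x) =
    ZMod.castHom (dvd_pow_self p two_ne_zero) (ZMod p) (augB p b) • s.aug₁ x := by
  ext
  · rw [aug₁_fst, Prod.smul_fst, aug₁_fst, smul_eq_mul]
    apply incl_injective p
    rw [mul_comm, incl_mul, incl_rho, incl_rho]
    change augB p (B.bd _) = _
    rw [B.bd_op_smul, map_mul]; rfl
  · rw [aug₁_snd, Prod.smul_snd, aug₁_snd, smul_eq_mul, ← augA_q, mul_comm, ← map_mul]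
    congr 1
    apply B.sus_injective
    rw [← B.op_smul_sus, s.sus_sComp, s.sus_sComp, smul_sub, ← s.u_mul]
    congr 2
    exact Subtype.ext (B.bd_op_smul _ _)

theorem aug₁_gen_smul (e : SteenrodGen p) (x : B.B₁) :
    s.aug₁ ((FreeAlgebra.ι (ZMod (p ^ 2)) e : B0 p) • x) = actF p (genA e) (s.aug₁ x) := by
  obtain ⟨_, _, h2⟩ := exists_proj B.internal
  refine AddSubgroup.iSup_induction B.gr (C := fun x =>
    s.aug₁ ((FreeAlgebra.ι (ZMod (p ^ 2)) e : B0 p) • x) = actF p (genA e) (s.aug₁ x)) (h2 x)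
    ?_ ?_ ?_
  · intro n x hx
    have hact : ∀ v : ZMod p × ZMod p,
        actF p (genA e) v = if e.deg = 1 then (0, v.1) else 0 := by
      intro v
      rw [actF, liftA_gen]
      split_ifs <;> simp
    have he : (FreeAlgebra.ι (ZMod (p ^ 2)) e : B0 p) ∈ B0gr p e.deg :=
      Submodule.subset_span ⟨[e], by simp, by simp⟩
    have hfst : (s.aug₁ ((FreeAlgebra.ι (ZMod (p ^ 2)) e : B0 p) • x)).1 = 0 := by
      apply incl_injective p
      rw [aug₁_fst, incl_rho, map_zero]
      change augB p (B.bd _) = 0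
      rw [map_smul, smul_eq_mul, map_mul, augB, FreeAlgebra.lift_ι_apply, zero_mul]
    rw [hact]
    by_cases hd : e.deg = 1 ∧ n = 0
    · obtain ⟨hd, rfl⟩ := hd
      rw [if_pos hd]
      refine Prod.ext hfst ?_
      change augA p (s.sComp _) = rho p (B.bdR x)
      obtain ⟨t, ht⟩ := ZMod.castHom_surjective (dvd_pow_self p two_ne_zero) (rho p (B.bdR x))
      have hr : B.bd x = (p : B0 p) * algebraMap (ZMod (p ^ 2)) (B0 p) t := by
        have h1 := B0gr_zero (B.bd_mem hx)
        have h2 := incl_rho (B.bdR x)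
        rw [← ht, incl_castHom] at h2
        change _ = augB p (B.bd x) at h2
        rw [h1, ← h2, map_mul, map_natCast]
        exact Algebra.commutes _ _
      have hp : (p : B0 p) ∈ RB p := by
        rw [RingHom.mem_ker, map_natCast]
        have : ((p : ZMod p) : ZMod p) = 0 := ZMod.natCast_self p
        rw [← map_natCast (algebraMap (ZMod p) (Steenrod p)), this, map_zero]
      have hp0 : (p : B0 p) ∈ B0gr p 0 := by
        have : (p : B0 p) = (p : ZMod (p ^ 2)) • (1 : B0 p) := by
          rw [Algebra.smul_def, mul_one, map_natCast]
        rw [this]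
        exact Submodule.smul_mem (Submodule.span _ _) _ (Submodule.subset_span ⟨[], by simp⟩)
      set P : RB p := ⟨p, hp⟩ with hP
      have hk := B.kappa (s.u P) (s.u_mem P hp0) (s.bd_u P) e
      have hkap : kappaGen e = (1 : Steenrod p) := by
        have hp1 : 2 ≤ p := (Fact.out : p.Prime).two_le
        cases e with
        | Sq h n hn =>
          change n = 1 at hd
          subst hd
          simp [kappaGen, sq]
        | P h n hn =>
          exfalso
          change 2 * n * (p - 1) = 1 at hd
          rw [mul_assoc] at hd
          omega
        | bP h n =>
          change 2 * n * (p - 1) + 1 = 1 at hd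
          have : n = 0 := by
            rcases Nat.eq_zero_or_pos n with h0 | h0
            · exact h0
            · have := Nat.mul_pos (Nat.mul_pos two_pos h0) (show 0 < p - 1 by omega)
              omega
          subst this
          simp [kappaGen, pw]
      have hu : s.u (B.bdR x) =
          MulOpposite.op (algebraMap (ZMod (p ^ 2)) (B0 p) t) • s.u P := by
        rw [← s.u_mul]
        congr 1
        exact Subtype.ext hr
      have hu' : s.u (B.bdR ((FreeAlgebra.ι (ZMod (p ^ 2)) e : B0 p) • x)) =
          MulOpposite.op (algebraMap (ZMod (p ^ 2)) (B0 p) t) •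
            MulOpposite.op (FreeAlgebra.ι (ZMod (p ^ 2)) e : B0 p) • s.u P := by
        rw [← s.u_mul, ← s.u_mul]
        congr 1
        refine Subtype.ext ?_
        change B.bd _ = (p : B0 p) * _ * _
        rw [map_smul, hr, smul_eq_mul, ← mul_assoc, Nat.cast_comm]
      have hs : augA p (q p (FreeAlgebra.ι _ e) * s.sComp x) = 0 := by
        rw [map_mul, q_gen, augA_gen, zero_mul]
      have h3 : s.sComp ((FreeAlgebra.ι (ZMod (p ^ 2)) e : B0 p) • x) =
          (-1 : ℤ) ^ e.deg • (q p (FreeAlgebra.ι _ e) * s.sComp x) +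
            algebraMap (ZMod p) (Steenrod p) (rho p (B.bdR x)) := by
        apply B.sus_injective
        rw [s.sus_sComp, hu', map_add, map_zsmul, ← B.smul_sus _ he, s.sus_sComp, smul_sub, hu,
          ← one_mul (algebraMap (ZMod p) (Steenrod p) _), ← ht, ← q_scalar,
          ← B.op_smul_sus, ← hkap, ← hk, smul_sub, smul_comm (M := B0 p)]
        abel
      rw [h3, map_add, map_zsmul, hs, AlgHom.commutes]
      simp
    · have hz : (if e.deg = 1 then ((0 : ZMod p), (s.aug₁ x).1) else 0) = 0 := by
        split_ifs with h
        · obtain ⟨m, rfl⟩ := Nat.exists_eq_succ_of_ne_zero (fun h0 => hd ⟨h, h0⟩)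
          rw [aug₁_fst, rho_eq_zero hx]; rfl
        · rfl
      rw [hz]
      refine Prod.ext hfst ?_
      have := deg_pos e
      exact augA_eq_zero_of_sus_mem (s.sus_sComp_mem (B.smul_mem he hx)) (by omega)
  · simp
  · intro x y hx hy
    rw [smul_add, map_add, map_add, hx, hy, map_add]

theorem aug₁_smul (b : B0 p) (x : B.B₁) : s.aug₁ (b • x) = actF p (q p b) (s.aug₁ x) := by
  induction b using FreeAlgebra.induction generalizing x with
  | grade0 r =>
    rw [B.scalar_comm, aug₁_op_smul, q_scalar, AlgHom.commutes, AlgHom.commutes]; rfl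
  | grade1 e => rw [q_gen]; exact s.aug₁_gen_smul e x
  | mul a b ha hb => rw [mul_smul, ha, hb, map_mul, map_mul]; rfl
  | add a b ha hb => rw [add_smul, map_add, ha, hb, map_add, map_add]; rfl

end Splitting

end

section
variable {p : ℕ} [Fact p.Prime] {B : SecondaryAlgebra p} (s : Splitting B)

/-- The grading of `𝔾`, concentrated in degree zero. -/
def gSigmaGr₀ (p : ℕ) : ℕ → AddSubgroup (ZMod (p ^ 2))
  | 0 => ⊤
  | _ + 1 => ⊥

/-- The grading of `𝔽 ⊕ Σ𝔽`. -/
def gSigmaGr₁ (p : ℕ) : ℕ → AddSubgroup (ZMod p × ZMod p)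
  | 0 => (AddMonoidHom.snd (ZMod p) (ZMod p)).ker
  | 1 => (AddMonoidHom.fst (ZMod p) (ZMod p)).ker
  | _ + 2 => ⊥

theorem gSigmaGr₀_internal (p : ℕ) : DirectSum.IsInternal (gSigmaGr₀ p) := by
  refine isInternal_of_proj (fun n => if n = 0 then AddMonoidHom.id _ else 0) ?_ ?_
  · rintro (_ | m) (_ | n) x hx
    · simp
    · simp
    · have : x = 0 := hx
      simp [this]
    · have : x = 0 := hx
      simp [this]
  · intro x
    exact AddSubgroup.mem_iSup_of_mem 0 (show x ∈ gSigmaGr₀ p 0 from AddSubgroup.mem_top x)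

theorem gSigmaGr₁_internal (p : ℕ) : DirectSum.IsInternal (gSigmaGr₁ p) := by
  refine isInternal_of_proj (fun n => match n with
    | 0 => (AddMonoidHom.inl _ _).comp (AddMonoidHom.fst (ZMod p) (ZMod p))
    | 1 => (AddMonoidHom.inr _ _).comp (AddMonoidHom.snd (ZMod p) (ZMod p))
    | _ + 2 => 0) ?_ ?_
  · rintro (_ | _ | m) (_ | _ | n) ⟨x, y⟩ hx
    · have : y = 0 := hx
      simp [this]
    · have : y = 0 := hx
      simp [this]
    · simp
    · have : x = 0 := hx
      simp [this]
    · have : x = 0 := hx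
      simp [this]
    · simp
    · have : (x, y) = 0 := hx
      simp [this]
    · have : (x, y) = 0 := hx
      simp [this]
    · have : (x, y) = 0 := hx
      simp [this]
  · rintro ⟨x, y⟩
    have h : ((x, y) : ZMod p × ZMod p) = (x, 0) + (0, y) := by simp
    rw [h]
    exact add_mem
      (AddSubgroup.mem_iSup_of_mem 0 (show ((x, 0) : ZMod p × ZMod p) ∈ gSigmaGr₁ p 0 from rfl))
      (AddSubgroup.mem_iSup_of_mem 1 (show ((0, y) : ZMod p × ZMod p) ∈ gSigmaGr₁ p 1 from rfl))

/-- `ℬ₀` acts on `𝔾` through the augmentation. -/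
noncomputable abbrev modG (p : ℕ) : Module (B0 p) (ZMod (p ^ 2)) :=
  Module.compHom _ (augB p : B0 p →+* ZMod (p ^ 2))

/-- `ℬ₀` acts on `𝔽 ⊕ Σ𝔽` through `𝒜`. -/
noncomputable abbrev modF (p : ℕ) [Fact p.Prime] : Module (B0 p) (ZMod p × ZMod p) :=
  Module.compHom _ ((actF p : Steenrod p →+* Module.End (ZMod p) (ZMod p × ZMod p)).comp (q p))

theorem aug₁_mem {n : ℕ} {x : B.B₁} (hx : x ∈ B.gr n) : s.aug₁ x ∈ gSigmaGr₁ p n := by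
  rcases n with _ | _ | n
  · exact augA_eq_zero_of_sus_mem (s.sus_sComp_mem hx) (by omega)
  · exact Splitting.rho_eq_zero hx
  · exact Prod.ext (Splitting.rho_eq_zero hx)
      (augA_eq_zero_of_sus_mem (s.sus_sComp_mem hx) (by omega))

theorem actF_gen (e : SteenrodGen p) (v : ZMod p × ZMod p) :
    actF p (genA e) v = if e.deg = 1 then (0, v.1) else 0 := by
  rw [actF, liftA_gen]
  split_ifs <;> simp

theorem actF_mem {m n : ℕ} {b : B0 p} {v : ZMod p × ZMod p} (hb : b ∈ B0gr p m)
    (hv : v ∈ gSigmaGr₁ p n) : actF p (q p b) v ∈ gSigmaGr₁ p (m + n) := by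
  change b ∈ Submodule.span _ _ at hb
  induction hb using Submodule.span_induction with
  | mem x hx =>
    obtain ⟨l, rfl, rfl⟩ := hx
    induction l with
    | nil => simpa using hv
    | cons e l ih =>
      rw [List.map_cons, List.map_cons, List.prod_cons, map_mul, map_mul, q_gen,
        Module.End.mul_apply, actF_gen, List.sum_cons, add_assoc]
      generalize (l.map SteenrodGen.deg).sum + n = k at ih
      split_ifs with h
      · rw [h, add_comm]
        rcases k with _ | _ | k
        · rfl
        · have h1 : (actF p (q p (l.map (FreeAlgebra.ι (ZMod (p ^ 2)))).prod) v).1 = 0 := ih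
          rw [h1]; exact zero_mem _
        · have h1 : actF p (q p (l.map (FreeAlgebra.ι (ZMod (p ^ 2)))).prod) v = 0 := ih
          rw [h1]; exact zero_mem _
      · exact zero_mem _
  | zero => rw [map_zero, map_zero]; exact zero_mem _
  | add x y _ _ hx hy => rw [map_add, map_add]; exact add_mem hx hy
  | smul c x _ hx =>
    rw [Algebra.smul_def, map_mul, q_scalar, map_mul, AlgHom.commutes]
    obtain ⟨k, hk⟩ := ZMod.intCast_surjective (ZMod.castHom (dvd_pow_self p two_ne_zero) (ZMod p) c)
    rw [← hk, map_intCast]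
    change (k : Module.End (ZMod p) (ZMod p × ZMod p)) _ ∈ _
    rw [Module.End.intCast_apply]
    exact zsmul_mem hx k

theorem incl_fst_smul (b : B0 p) (v : ZMod p × ZMod p) :
    incl p (actF p (q p b) v).1 = augB p b * incl p v.1 := by
  rw [actF_fst, augA_q, mul_comm, incl_mul, mul_comm]

/-- The `ℬ`-module `𝔾^Σ = (𝔽 ⊕ Σ𝔽 → 𝔾)`: `∂` is the inclusion `x ↦ px` on `𝔽` and zero on `Σ𝔽`,
`ℬ` acts through the augmentation `ℬ → 𝔾^Σ` determined by the splitting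
`ℬ₁ = u(R_ℬ) ⊕ Σ𝒜`. -/
noncomputable def GSigma : PairModule B.toPairAlgebra where
  M₀ := ZMod (p ^ 2)
  M₁ := ZMod p × ZMod p
  module₀ := modG p
  module₁ := modF p
  gr₀ := gSigmaGr₀ p
  gr₁ := gSigmaGr₁ p
  internal₀ := gSigmaGr₀_internal p
  internal₁ := gSigmaGr₁_internal p
  smul_mem₀ := fun {m n b y} hb hy => by
    change augB p b * y ∈ _
    rcases n with _ | n
    · rcases m with _ | m
      · trivial
      · rw [augB_eq_zero hb, zero_mul]; exact zero_mem _
    · have : y = 0 := hy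
      rw [this, mul_zero]; exact zero_mem _
  smul_mem₁ := fun hb hy => actF_mem hb hy
  bd := letI := modG p; letI := modF p
    { toFun := fun v => incl p v.1
      map_add' := fun v w => map_add (incl p) v.1 w.1
      map_smul' := fun b v => incl_fst_smul b v }
  bd_mem := fun {n v} hv => by
    rcases n with _ | _ | n
    · trivial
    · have h : v.1 = 0 := hv
      change incl p v.1 = 0
      rw [h, map_zero]
    · have h : v = 0 := hv
      change incl p v.1 = 0
      rw [h, Prod.fst_zero, map_zero]
  act :=
    { toFun := fun x =>
        { toFun := fun n => ZMod.castHom (dvd_pow_self p two_ne_zero) (ZMod p) n • s.aug₁ x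
          map_zero' := by rw [map_zero, zero_smul]
          map_add' := fun m n => by rw [map_add, add_smul] }
      map_zero' := by ext n <;> simp
      map_add' := fun x y => AddMonoidHom.ext fun n => by
        change ZMod.castHom (dvd_pow_self p two_ne_zero) (ZMod p) n • s.aug₁ (x + y) =
          ZMod.castHom (dvd_pow_self p two_ne_zero) (ZMod p) n • s.aug₁ x +
            ZMod.castHom (dvd_pow_self p two_ne_zero) (ZMod p) n • s.aug₁ y
        rw [map_add, smul_add] }
  act_mem := fun {m n x y} hx hy => by
    change ZMod.castHom (dvd_pow_self p two_ne_zero) (ZMod p) y • s.aug₁ x ∈ _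
    rcases n with _ | n
    · obtain ⟨k, hk⟩ :=
        ZMod.intCast_surjective (ZMod.castHom (dvd_pow_self p two_ne_zero) (ZMod p) y)
      rw [← hk, Int.cast_smul_eq_zsmul]
      exact zsmul_mem (aug₁_mem s hx) k
    · have : y = 0 := hy
      rw [this, map_zero, zero_smul]; exact zero_mem _
  smul_act := fun b x n => by
    change ZMod.castHom (dvd_pow_self p two_ne_zero) (ZMod p) n • s.aug₁ (b • x) =
      actF p (q p b) (ZMod.castHom (dvd_pow_self p two_ne_zero) (ZMod p) n • s.aug₁ x)
    rw [s.aug₁_smul, map_smul]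
  act_smul := fun b x n => by
    change ZMod.castHom (dvd_pow_self p two_ne_zero) (ZMod p) n •
        s.aug₁ (MulOpposite.op b • x) =
      ZMod.castHom (dvd_pow_self p two_ne_zero) (ZMod p) (augB p b * n) • s.aug₁ x
    rw [s.aug₁_op_smul, smul_smul, map_mul, mul_comm]
  bd_act := fun x n => by
    change incl p (_ * (s.aug₁ x).1) = augB p (B.bd x) * n
    rw [Splitting.aug₁_fst, mul_comm, incl_mul, incl_rho]; rfl
  act_bd := fun x v => by
    change ZMod.castHom (dvd_pow_self p two_ne_zero) (ZMod p) (incl p v.1) • s.aug₁ x =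
      actF p (q p (B.bd x)) v
    have h1 : q p (B.bd x) = 0 := B.bd_mem_RB x
    have h2 : ZMod.castHom (dvd_pow_self p two_ne_zero) (ZMod p) (incl p v.1) = 0 := by
      obtain ⟨k, hk⟩ := ZMod.intCast_surjective v.1
      rw [← hk, incl_intCast, map_mul, map_natCast, ZMod.natCast_self, mul_zero]
    rw [h1, h2, map_zero, zero_smul]; rfl

end

/-! ### Secondary complexes -/

/-- A sequence `M₀ ← M₁ ← M₂ ← ⋯` of homomorphisms of `B`-modules (with `Mₙ = 0` for `n < 0`);
composites are not assumed to vanish. -/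
structure PreComplex {p : ℕ} (B : PairAlgebra p) where
  M : ℕ → PairModule B
  d : ∀ n, PairModule.Hom (M (n + 1)) (M n)

/-- A completion of a sequence of `B`-modules to a secondary chain complex: degree preserving
`B₀`-linear maps `Hₙ : M_{n+2,0} → M_{n,1}` with `∂H = dd`, `H∂ = dd` and `Hd = dH`. -/
@[ext]
structure PreComplex.Completion {p : ℕ} {B : PairAlgebra p} (C : PreComplex B) where
  H : ∀ n, (C.M (n + 2)).M₀ →ₗ[B0 p] (C.M n).M₁
  H_mem : ∀ {n k : ℕ} {x : (C.M (n + 2)).M₀}, x ∈ (C.M (n + 2)).gr₀ k → H n x ∈ (C.M n).gr₁ k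
  bd_H : ∀ n x, (C.M n).bd (H n x) = (C.d n).f₀ ((C.d (n + 1)).f₀ x)
  H_bd : ∀ n y, H n ((C.M (n + 2)).bd y) = (C.d n).f₁ ((C.d (n + 1)).f₁ y)
  H_d : ∀ n x, H n ((C.d (n + 2)).f₀ x) = (C.d n).f₁ (H (n + 1) x)

/-- Secondary exactness, i.e. exactness of the total complex: every secondary cycle `(c, γ)`,
`c ∈ M_{n,0}`, `γ ∈ M_{n-1,1}`, `d c = ∂ γ`, `H c = d γ`, is a secondary boundary
`(d b + ∂ β, H b + d β)`, `b ∈ M_{n+1,0}`, `β ∈ M_{n,1}`. The three clauses are the cases `n = 0`,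
`n = 1` and `n ≥ 2`. -/
def PreComplex.Completion.Exact {p : ℕ} {B : PairAlgebra p} {C : PreComplex B}
    (K : C.Completion) : Prop :=
  (∀ c : (C.M 0).M₀, ∃ (b : (C.M 1).M₀) (β : (C.M 0).M₁),
    c = (C.d 0).f₀ b + (C.M 0).bd β) ∧
  (∀ (c : (C.M 1).M₀) (γ : (C.M 0).M₁), (C.d 0).f₀ c = (C.M 0).bd γ →
    ∃ (b : (C.M 2).M₀) (β : (C.M 1).M₁),
      c = (C.d 1).f₀ b + (C.M 1).bd β ∧ γ = K.H 0 b + (C.d 0).f₁ β) ∧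
  (∀ n, ∀ (c : (C.M (n + 2)).M₀) (γ : (C.M (n + 1)).M₁),
    (C.d (n + 1)).f₀ c = (C.M (n + 1)).bd γ → K.H n c = (C.d n).f₁ γ →
    ∃ (b : (C.M (n + 3)).M₀) (β : (C.M (n + 2)).M₁),
      c = (C.d (n + 2)).f₀ b + (C.M (n + 2)).bd β ∧
        γ = K.H (n + 1) b + (C.d (n + 1)).f₁ β)

/-! ### Resolutions -/

/-- A minimal resolution `𝔽 ← 𝒜⟨g₀⟩ ← 𝒜⟨g₁⟩ ← ⋯` of `𝔽` by free left `𝒜`-modules on graded sets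
`gen m`. -/
structure MinimalResolution (p : ℕ) [Fact p.Prime] where
  gen : ℕ → Type
  deg : ∀ {m}, gen m → ℕ
  g₀ : gen 0
  gen_zero : ∀ g : gen 0, g = g₀
  deg_g₀ : deg g₀ = 0
  /-- the value of the differential on a generator -/
  D : ∀ {m}, gen (m + 1) → (gen m →₀ Steenrod p)
  D_mem : ∀ {m} (g : gen (m + 1)), D g ∈ freeGr (Agr p) deg (deg g)
  minimal : ∀ {m} (g : gen (m + 1)) (h : gen m), augA p (D g h) = 0
  exact_zero : ∀ x : gen 0 →₀ Steenrod p, augA p (x g₀) = 0 ↔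
    ∃ y, Finsupp.linearCombination (Steenrod p) (D (m := 0)) y = x
  exact_succ : ∀ m (x : gen (m + 1) →₀ Steenrod p),
    Finsupp.linearCombination (Steenrod p) (D (m := m)) x = 0 ↔
      ∃ y, Finsupp.linearCombination (Steenrod p) (D (m := m + 1)) y = x

section
variable {p : ℕ} [Fact p.Prime]

/-- The differential `d : 𝒜⟨g_{m+1}⟩ → 𝒜⟨g_m⟩`. It is also used for the differential
`Σ𝒜⟨g_{m+1}⟩ → Σ𝒜⟨g_m⟩`, given by the same matrix: since `(Σx) a = Σ(xa)`, it sends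
`(Σx) g` to `(Σx) d(g) = Σ(x d(g))`. -/
noncomputable def MinimalResolution.d (R : MinimalResolution p) (m : ℕ) :
    (R.gen (m + 1) →₀ Steenrod p) →ₗ[Steenrod p] (R.gen m →₀ Steenrod p) :=
  Finsupp.linearCombination (Steenrod p) R.D

/-- A lift of the matrices of the differentials of a resolution to homogeneous matrices over
`ℬ₀`. -/
structure Lift (R : MinimalResolution p) where
  D : ∀ {m}, R.gen (m + 1) → (R.gen m →₀ B0 p)
  D_mem : ∀ {m} (g : R.gen (m + 1)), D g ∈ freeGr (B0gr p) R.deg (R.deg g)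
  q_D : ∀ {m} (g : R.gen (m + 1)) (h : R.gen m), q p (D g h) = R.D g h

namespace Lift
variable {R : MinimalResolution p} (L : Lift R)

/-- The map `d : ℬ₀⟨g_{m+1}⟩ → ℬ₀⟨g_m⟩`. -/
noncomputable def d (m : ℕ) : (R.gen (m + 1) →₀ B0 p) →ₗ[B0 p] (R.gen m →₀ B0 p) :=
  Finsupp.linearCombination (B0 p) L.D

theorem q_d (m : ℕ) (x : R.gen (m + 1) →₀ B0 p) :
    Finsupp.mapRange.addMonoidHom (q p : B0 p →+ Steenrod p) (L.d m x) =
      R.d m (Finsupp.mapRange.addMonoidHom (q p : B0 p →+ Steenrod p) x) := by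
  induction x using Finsupp.induction_linear with
  | zero => simp
  | add x y hx hy => rw [map_add, map_add, hx, hy, map_add, map_add]
  | single g b =>
    ext h
    simp [d, MinimalResolution.d, ← L.q_D]

theorem d_d (m : ℕ) (x : R.gen (m + 2) →₀ Steenrod p) : R.d m (R.d (m + 1) x) = 0 :=
  (R.exact_succ m _).2 ⟨x, rfl⟩

/-- The coefficients of `d d (x)` lie in `R_ℬ`. -/
theorem dd_mem (m : ℕ) (x : R.gen (m + 2) →₀ B0 p) (h : R.gen m) :
    L.d m (L.d (m + 1) x) h ∈ RB p := by
  have h1 := L.q_d m (L.d (m + 1) x)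
  rw [L.q_d (m + 1) x, d_d] at h1
  exact DFunLike.congr_fun h1 h

/-- The coefficient of `h` in `d d (x)`, as an element of `R_ℬ`. -/
noncomputable def dd (m : ℕ) (x : R.gen (m + 2) →₀ B0 p) (h : R.gen m) : RB p :=
  ⟨L.d m (L.d (m + 1) x) h, L.dd_mem m x h⟩

end Lift

variable {B : SecondaryAlgebra p} (s : Splitting B) (R : MinimalResolution p) (L : Lift R)

/-- The modules `𝔾^Σ, ℬ⟨g₀⟩, ℬ⟨g₁⟩, …`. -/
noncomputable def liftM : ℕ → PairModule B.toPairAlgebra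
  | 0 => GSigma s
  | m + 1 => PairModule.free B.toPairAlgebra (R.deg (m := m))

/-- The sequence `𝔾^Σ ← ℬ⟨g₀⟩ ← ℬ⟨g₁⟩ ← ⋯` of `ℬ`-module homomorphisms which sends `g₀` to
`1 ∈ 𝔾` and is given by the matrices of the lift otherwise. -/
noncomputable def liftComplex : PreComplex B.toPairAlgebra where
  M := liftM s R
  d := fun
    | 0 => PairModule.freeLift (R.deg (m := 0)) (GSigma s) (fun _ => (1 : ZMod (p ^ 2))) (by
        intro g
        rw [R.gen_zero g, R.deg_g₀]
        trivial)
    | m + 1 => PairModule.freeLift (R.deg (m := m + 1))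
        (PairModule.free B.toPairAlgebra (R.deg (m := m))) L.D L.D_mem

/-- The class of `x ∈ ℬ₀⟨g_m⟩` in `𝒜⟨g_m⟩`. -/
noncomputable def toA {I : Type} : (I →₀ B0 p) →+ (I →₀ Steenrod p) :=
  Finsupp.mapRange.addMonoidHom (q p : B0 p →+ Steenrod p)

/-- A family of additive degree preserving maps `δ_m : 𝒜⟨g_{m+2}⟩ → Σ𝒜⟨g_m⟩` satisfies
`δ(a g) = a δ(g) + A(a, dd g)`, where `A(a, r h) = A(a, r) h` and `a · Σx = (-1)^{|a|} Σ(ax)`.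
An element of `Σ𝒜⟨g_m⟩` is represented by its coefficients in `𝒜`. -/
structure IsTwisted (δ : ∀ m, (R.gen (m + 2) →₀ Steenrod p) →+ (R.gen m →₀ Steenrod p)) :
    Prop where
  mem : ∀ {m k : ℕ} {x : R.gen (m + 2) →₀ Steenrod p}, x ∈ freeGr (Agr p) R.deg k →
    δ m x ∈ freeGr (suspGr (Agr p)) R.deg k
  single : ∀ (m : ℕ) (g : R.gen (m + 2)) {n : ℕ} {a : Steenrod p}, a ∈ Agr p n →
    ∀ h, δ m (Finsupp.single g a) h = (-1 : ℤ) ^ n • (a * δ m (Finsupp.single g 1) h) +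
      s.A a (L.dd m (Finsupp.single g 1) h)

/-- The systems of maps `δ_m : 𝒜⟨g_{m+2}⟩ → Σ𝒜⟨g_m⟩` as above with `d δ g = δ d g` for all
generators `g`. -/
@[ext]
structure DeltaSystem where
  δ : ∀ m, (R.gen (m + 2) →₀ Steenrod p) →+ (R.gen m →₀ Steenrod p)
  twisted : IsTwisted s R L δ
  comm : ∀ (m : ℕ) (g : R.gen (m + 3)),
    R.d m (δ (m + 1) (Finsupp.single g 1)) = δ m (R.d (m + 2) (Finsupp.single g 1))

/-- The maps `H_{m+1} : ℬ₀⟨g_{m+2}⟩ → ℬ₁⟨g_m⟩` of a completion of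
`𝔾^Σ ← ℬ⟨g₀⟩ ← ℬ⟨g₁⟩ ← ⋯`. -/
noncomputable def homotopy {s : Splitting B} {R : MinimalResolution p} {L : Lift R}
    (K : (liftComplex s R L).Completion) (m : ℕ) (x : R.gen (m + 2) →₀ B0 p) : R.gen m →₀ B.B₁ :=
  K.H (m + 1) x

/-- The map `H₀ : ℬ₀⟨g₁⟩ → 𝔽 ⊕ Σ𝔽` of a completion. -/
noncomputable def bottom {s : Splitting B} {R : MinimalResolution p} {L : Lift R}
    (K : (liftComplex s R L).Completion) : (R.gen 1 →₀ B0 p) →ₗ[B0 p] (GSigma s).M₁ :=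
  K.H 0

/-- The completion `K` corresponds to `δ`: its maps are `(dd, δ)` with respect to the decomposition
`ℬ₁ = u(R_ℬ) ⊕ Σ𝒜`. -/
def Corresponds {s : Splitting B} {R : MinimalResolution p} {L : Lift R}
    (K : (liftComplex s R L).Completion) (Δ : DeltaSystem s R L) : Prop :=
  ∀ (m : ℕ) (x : R.gen (m + 2) →₀ B0 p) (h : R.gen m),
    homotopy K m x h = s.u (L.dd m x h) + B.sus (Δ.δ m (toA x) h)

/-! ### The augmented resolution as a complex -/

/-- `C₀ = 𝔽`, `C_{m+1} = 𝒜⟨g_m⟩`. -/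
def Aug : ℕ → Type
  | 0 => ZMod p
  | m + 1 => R.gen m →₀ Steenrod p

noncomputable instance : ∀ n, AddCommGroup (Aug R n)
  | 0 => inferInstanceAs (AddCommGroup (ZMod p))
  | m + 1 => inferInstanceAs (AddCommGroup (R.gen m →₀ Steenrod p))

/-- The differential of the augmented resolution `C`. -/
noncomputable def augD : ∀ n, Aug R (n + 1) →+ Aug R n
  | 0 => (augA p : Steenrod p →+ ZMod p).comp (Finsupp.applyAddHom R.g₀)
  | m + 1 => (R.d m).toAddMonoidHom

/-- `C` is acyclic. -/
def AugAcyclic : Prop :=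
  (∀ x : Aug R 0, ∃ y, augD R 0 y = x) ∧
    ∀ n (x : Aug R (n + 1)), augD R n x = 0 ↔ ∃ y, augD R (n + 1) y = x

/-- A family of maps `f_n : C_{n+2} → C_n` is a quasi-isomorphism from `C`, shifted by two, to `C`:
it is a chain map and induces isomorphisms on homology (in the two lowest degrees the target is
zero). -/
def IsQuasiIso (f : ∀ n, Aug R (n + 2) →+ Aug R n) : Prop :=
  (∀ n x, augD R n (f (n + 1) x) = f n (augD R (n + 2) x)) ∧
  (∀ x : Aug R 0, ∃ y, augD R 0 y = x) ∧
  (∀ x : Aug R 1, augD R 0 x = 0 → ∃ y, augD R 1 y = x) ∧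
  (∀ x : Aug R 2, augD R 1 x = 0 → (∃ y, augD R 0 y = f 0 x) → ∃ z, augD R 2 z = x) ∧
  (∀ n (x : Aug R (n + 3)), augD R (n + 2) x = 0 → (∃ y, augD R (n + 1) y = f (n + 1) x) →
    ∃ z, augD R (n + 3) z = x) ∧
  (∀ y : Aug R 0, ∃ x z, augD R 1 x = 0 ∧ f 0 x = y + augD R 0 z) ∧
  (∀ n (y : Aug R (n + 1)), augD R n y = 0 →
    ∃ x z, augD R (n + 2) x = 0 ∧ f (n + 1) x = y + augD R (n + 1) z)

/-- The map `δ̄ : C_{n+2} → ΣC_n`: in the lowest degree it is the map `𝒜⟨g₁⟩ → Σ𝔽` induced by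
`η : ℬ₀⟨g₁⟩ → 𝔽 ⊕ Σ𝔽`, and `δ` in the other degrees. -/
noncomputable def deltaBar {s : Splitting B} {R : MinimalResolution p} {L : Lift R}
    (η : (R.gen 1 →₀ B0 p) →ₗ[B0 p] (GSigma s).M₁) (Δ : DeltaSystem s R L) :
    ∀ n, Aug R (n + 2) →+ Aug R n
  | 0 => Finsupp.liftAddHom fun g =>
      (AddMonoidHom.mulRight (show ZMod p × ZMod p from η (Finsupp.single g 1)).2).comp
        (augA p : Steenrod p →+ ZMod p)
  | m + 1 => Δ.δ m

end

end SecondaryResolution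

open SecondaryResolution

/-!
An element `x` of `ℬ₁ = u(R_ℬ) ⊕ Σ𝒜` is determined by its boundary `∂x` and its `Σ𝒜`-component
`sComp x`. The boundary of a map `H : ℬ₀⟨g_{m+2}⟩ → ℬ₁⟨g_m⟩` of a completion is prescribed by
`∂H = dd`, so `H` amounts to its `Σ𝒜`-component. Since `sComp` is right `ℬ₀`-equivariant
(`sComp_op_smul`), it commutes with the differentials, and `H∂ = dd` shows that the component of
`H` vanishes on the image of `∂`, as `dd = 0` in the resolution. The component therefore factors
through a map `δ : 𝒜⟨g_{m+2}⟩ → Σ𝒜⟨g_m⟩` (`exists_twisted_of_homotopy`). The `ℬ₀`-linearity of `H`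
is the twisted linearity of `δ`, because `A` measures the failure of `u` to be left equivariant, and
`Hd = dH` is `δd = dδ`, because both sides of the former have the boundary `ddd`.

In the other direction a `ℬ₀`-linear `H` is built from its values on generators
(`exists_homotopy`), and twisted maps are determined by their values on generators
(`IsTwisted.ext_gen`). So every twisted family comes from homotopies, and a relation between
`ℬ₀`-linear maps need only be checked on generators. The relation `H∂ = dd` is automatic on free
modules (`homotopy_bd`).

The choice of `η` puts no condition on `δ`: by minimality the generators `g_m` have degree at least
`m` (`MinimalResolution.le_deg`), so for degree reasons both sides of every relation that involves
`η` vanish on generators (`bd_bottom`, `bottom_comm`).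

Finally every completion is exact. For a secondary cycle `(c, γ)` exactness of the resolution makes
the class of `c` a boundary; subtracting a secondary boundary leaves a cycle `(0, Σz)` with
`dz = 0`, and exactness applied to `z` finishes (`exists_boundary`). At the bottom the remainder
lies in `Σ𝔽`, and surjectivity of `ε : 𝒜 → 𝔽` is used instead (`exists_boundary_bottom`). As `C` is
acyclic, the chain map `δ̄` is a quasi-isomorphism, so exactness and this condition are equivalent
because both always hold.
-/

namespace SecondaryResolution

/-! ### Graded lifts -/

section
variable {p : ℕ}

theorem exists_finsupp_lift {I X Y : Type} [AddCommGroup X] [AddCommGroup Y] (φ : X →+ Y)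
    (S : I → AddSubgroup X) (y : I →₀ Y) (h : ∀ i, ∃ x ∈ S i, φ x = y i) :
    ∃ x : I →₀ X, (∀ i, x i ∈ S i) ∧ Finsupp.mapRange.addMonoidHom φ x = y := by
  classical
  choose f hS hf using h
  refine ⟨Finsupp.onFinset y.support (fun i => if y i = 0 then 0 else f i) ?_, ?_, ?_⟩
  · intro i hi
    rw [Finsupp.mem_support_iff]
    exact fun h0 => hi (if_pos h0)
  · intro i
    rw [Finsupp.onFinset_apply]
    split_ifs
    · exact zero_mem _
    · exact hS i
  · ext i
    rw [Finsupp.mapRange.addMonoidHom_apply, Finsupp.mapRange_apply, Finsupp.onFinset_apply]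
    split_ifs with h0
    · rw [map_zero, h0]
    · exact hf i

theorem q_mem {n : ℕ} {b : B0 p} (hb : b ∈ B0gr p n) : q p b ∈ Agr p n := by
  change b ∈ Submodule.span _ _ at hb
  induction hb using Submodule.span_induction with
  | mem x hx =>
    obtain ⟨l, hl, rfl⟩ := hx
    refine Submodule.subset_span ⟨l, hl, ?_⟩
    rw [map_list_prod, List.map_map]
    congr 1
    exact List.map_congr_left fun e _ => q_gen e
  | zero => rw [map_zero]; exact zero_mem _
  | add x y _ _ hx hy => rw [map_add]; exact add_mem hx hy
  | smul c x _ hx =>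
    rw [Algebra.smul_def, map_mul, q_scalar, ← Algebra.smul_def]
    exact Submodule.smul_mem (Submodule.span _ _) _ hx

theorem exists_q_eq_of_mem {n : ℕ} {a : Steenrod p} (ha : a ∈ Agr p n) :
    ∃ b ∈ B0gr p n, q p b = a := by
  change a ∈ Submodule.span _ _ at ha
  induction ha using Submodule.span_induction with
  | mem x hx =>
    obtain ⟨l, hl, rfl⟩ := hx
    refine ⟨(l.map (FreeAlgebra.ι (ZMod (p ^ 2)))).prod, Submodule.subset_span ⟨l, hl, rfl⟩, ?_⟩
    rw [map_list_prod, List.map_map]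
    congr 1
    exact List.map_congr_left fun e _ => q_gen e
  | zero => exact ⟨0, zero_mem _, map_zero _⟩
  | add x y _ _ hx hy =>
    obtain ⟨b, hb, rfl⟩ := hx
    obtain ⟨c, hc, rfl⟩ := hy
    exact ⟨b + c, add_mem hb hc, map_add _ _ _⟩
  | smul c x _ hx =>
    obtain ⟨b, hb, rfl⟩ := hx
    obtain ⟨t, rfl⟩ := ZMod.castHom_surjective (dvd_pow_self p two_ne_zero) c
    refine ⟨t • b, Submodule.smul_mem (Submodule.span _ _) _ hb, ?_⟩
    rw [Algebra.smul_def, map_mul, q_scalar, ← Algebra.smul_def]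

theorem freeGr_single {X I : Type} [AddCommGroup X] {gr : ℕ → AddSubgroup X} {deg : I → ℕ}
    {n : ℕ} {x : X} (hx : x ∈ gr n) (g : I) : Finsupp.single g x ∈ freeGr gr deg (n + deg g) := by
  classical
  intro h
  rw [Finsupp.single_apply]
  split_ifs with hg
  · subst hg
    rwa [shiftGr_of_le]
  · exact zero_mem _

theorem freeGr_mapRange {X Y I : Type} [AddCommGroup X] [AddCommGroup Y]
    {gr : ℕ → AddSubgroup X} {gr' : ℕ → AddSubgroup Y} (φ : X →+ Y)
    (hφ : ∀ n x, x ∈ gr n → φ x ∈ gr' n) {deg : I → ℕ} {n : ℕ} {x : I →₀ X}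
    (hx : x ∈ freeGr gr deg n) :
    Finsupp.mapRange.addMonoidHom φ x ∈ freeGr gr' deg n := fun g => by
  have := shiftGr_map (gr' := gr') φ 0 (fun n x h => by rw [Nat.zero_add]; exact hφ n x h) _ _ _
    (hx g)
  rwa [Nat.zero_add] at this

theorem toA_mem {I : Type} {deg : I → ℕ} {n : ℕ} {x : I →₀ B0 p} (hx : x ∈ freeGr (B0gr p) deg n) :
    toA x ∈ freeGr (Agr p) deg n :=
  freeGr_mapRange (q p : B0 p →+ Steenrod p) (fun _ _ h => q_mem h) hx

theorem toA_surjective (I : Type) : Function.Surjective (toA : (I →₀ B0 p) →+ (I →₀ Steenrod p)) :=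
  fun x => by
    obtain ⟨y, -, h⟩ := exists_finsupp_lift (q p : B0 p →+ Steenrod p) (fun _ => ⊤) x
      fun i => (q_surjective p (x i)).imp fun _ h => ⟨trivial, h⟩
    exact ⟨y, h⟩

theorem exists_toA_eq_of_mem {I : Type} {deg : I → ℕ} {n : ℕ} {x : I →₀ Steenrod p}
    (hx : x ∈ freeGr (Agr p) deg n) : ∃ y ∈ freeGr (B0gr p) deg n, toA y = x := by
  refine exists_finsupp_lift (q p : B0 p →+ Steenrod p) (fun i => shiftGr (B0gr p) (deg i) n) x
    fun i => ?_
  have h := hx i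
  unfold shiftGr at h ⊢
  split_ifs at h ⊢
  · exact exists_q_eq_of_mem h
  · rw [AddSubgroup.mem_bot] at h
    exact ⟨0, zero_mem _, by rw [map_zero, h]⟩

theorem toA_single {I : Type} (g : I) (b : B0 p) :
    toA (Finsupp.single g b) = Finsupp.single g (q p b) := by
  simp [toA]

theorem exists_toA_factor {I X : Type} [AddCommGroup X] (φ : (I →₀ B0 p) →+ X)
    (h : ∀ x, toA x = 0 → φ x = 0) : ∃ ψ : (I →₀ Steenrod p) →+ X, ∀ x, ψ (toA x) = φ x := by
  have hφ : ∀ x y, toA x = toA y → φ x = φ y := by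
    intro x y hxy
    rw [← sub_eq_zero, ← map_sub φ]
    exact h _ (by rw [map_sub, hxy, sub_self])
  have hs := Function.surjInv_eq (toA_surjective (p := p) I)
  exact ⟨AddMonoidHom.mk' (fun x => φ (Function.surjInv (toA_surjective I) x)) fun x y => by
    rw [← map_add]
    exact hφ _ _ (by rw [hs, map_add, hs, hs]), fun x => hφ _ _ (hs _)⟩

theorem single_one_mem {I : Type} (deg : I → ℕ) (g : I) :
    (Finsupp.single g 1 : I →₀ B0 p) ∈ freeGr (B0gr p) deg (deg g) := by
  have h1 : (1 : B0 p) ∈ B0gr p 0 := Submodule.subset_span ⟨[], by simp, by simp⟩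
  simpa using freeGr_single (deg := deg) h1 g

/-- A linear map on a free module preserves degrees if its values on the generators do. -/
theorem linearCombination_mem {X I : Type} [AddCommGroup X] [Module (B0 p) X]
    {gr : ℕ → AddSubgroup X}
    (hsmul : ∀ {m n : ℕ} {b : B0 p} {x : X}, b ∈ B0gr p m → x ∈ gr n → b • x ∈ gr (m + n))
    {deg : I → ℕ} {v : I → X} (hv : ∀ g, v g ∈ gr (deg g)) {n : ℕ} {x : I →₀ B0 p}
    (hx : x ∈ freeGr (B0gr p) deg n) : Finsupp.linearCombination (B0 p) v x ∈ gr n := by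
  change (x.sum fun g b => b • v g) ∈ _
  exact AddSubgroup.sum_mem _ fun g _ => shiftGr_mem (gr' := gr)
    ((LinearMap.toSpanSingleton (B0 p) X (v g)).toAddMonoidHom) (deg g)
    (fun k b hb => hsmul hb (hv g)) n _ (hx g)

end

/-! ### The decomposition of `ℬ₁` -/

section
variable {p : ℕ} (B : SecondaryAlgebra p)

theorem SecondaryAlgebra.bd_sus (a : Steenrod p) : B.bd (B.sus a) = 0 := (B.exact₁ _).2 ⟨a, rfl⟩

theorem SecondaryAlgebra.sus_mem_of_mem_suspGr {n : ℕ} {a : Steenrod p}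
    (ha : a ∈ suspGr (Agr p) n) : B.sus a ∈ B.gr n := by
  cases n with
  | zero =>
    have h : a = 0 := ha
    rw [h, map_zero]
    exact zero_mem _
  | succ n => exact B.sus_mem ha

/-- The isomorphism `Σ𝒜 ≅ ker ∂` reflects degrees: the homogeneous components of `a` are carried to
those of `sus a`, so all but one of them vanish when `sus a` is homogeneous. -/
theorem SecondaryAlgebra.mem_suspGr_of_sus_mem [Fact p.Prime] {n : ℕ} {a : Steenrod p}
    (ha : B.sus a ∈ B.gr n) : a ∈ suspGr (Agr p) n := by
  obtain ⟨π, h1, -⟩ := exists_proj B.internal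
  have key : ∃ a' ∈ suspGr (Agr p) n, π n (B.sus a) = B.sus a' := by
    refine AddSubgroup.iSup_induction (Agr p)
      (C := fun a => ∃ a' ∈ suspGr (Agr p) n, π n (B.sus a) = B.sus a') (mem_iSup_Agr a) ?_ ?_ ?_
    · intro i c hc
      rw [h1 _ n _ (B.sus_mem hc)]
      split_ifs with h
      · subst h
        exact ⟨c, hc, rfl⟩
      · exact ⟨0, zero_mem _, (map_zero _).symm⟩
    · exact ⟨0, zero_mem _, by simp⟩
    · rintro x y ⟨x', hx, hx'⟩ ⟨y', hy, hy'⟩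
      exact ⟨x' + y', add_mem hx hy, by rw [map_add, map_add, map_add, hx', hy']⟩
  obtain ⟨a', h, h'⟩ := key
  rw [h1 _ n _ ha, if_pos rfl] at h'
  rwa [B.sus_injective h']

namespace Splitting
variable {B} (s : Splitting B)

theorem sComp_sus (a : Steenrod p) : s.sComp (B.sus a) = a := by
  apply B.sus_injective
  rw [s.sus_sComp]
  have h : B.bdR (B.sus a) = 0 := Subtype.ext (B.bd_sus a)
  rw [h, map_zero, sub_zero]

theorem bdR_u (r : RB p) : B.bdR (s.u r) = r := Subtype.ext (s.bd_u r)

theorem sComp_u (r : RB p) : s.sComp (s.u r) = 0 := by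
  apply B.sus_injective
  rw [s.sus_sComp, s.bdR_u, sub_self, map_zero]

/-- Elements of `ℬ₁ = u(R_ℬ) ⊕ Σ𝒜` are determined by their two components. -/
theorem ext_components {x y : B.B₁} (h : B.bd x = B.bd y) (h' : s.sComp x = s.sComp y) : x = y := by
  have hR : B.bdR x = B.bdR y := Subtype.ext h
  have := congrArg B.sus h'
  rw [s.sus_sComp, s.sus_sComp, hR] at this
  exact sub_left_inj.1 this

theorem sComp_op_smul (b : B0 p) (x : B.B₁) :
    s.sComp (MulOpposite.op b • x) = s.sComp x * q p b := by
  apply B.sus_injective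
  rw [← B.op_smul_sus, s.sus_sComp, s.sus_sComp, smul_sub, ← s.u_mul]
  congr 2
  exact Subtype.ext (B.bd_op_smul _ _)

theorem sComp_smul {n : ℕ} {b : B0 p} (hb : b ∈ B0gr p n) (x : B.B₁) :
    s.sComp (b • x) = (-1 : ℤ) ^ n • (q p b * s.sComp x) + s.A (q p b) (B.bdR x) := by
  apply B.sus_injective
  have h : B.bdR (b • x) = b • B.bdR x := Subtype.ext (map_smul B.bd b x)
  rw [map_add, map_zsmul, ← B.smul_sus _ hb, s.sus_A, s.sus_sComp, s.sus_sComp, smul_sub, h]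
  abel

theorem sComp_mem [Fact p.Prime] {n : ℕ} {x : B.B₁} (hx : x ∈ B.gr n) :
    s.sComp x ∈ suspGr (Agr p) n := by
  apply B.mem_suspGr_of_sus_mem
  rw [s.sus_sComp]
  exact sub_mem hx (s.u_mem _ (B.bd_mem hx))

end Splitting

variable {B}

/-- `∂` applied to coefficients. -/
noncomputable def bdF (B : SecondaryAlgebra p) {I : Type} : (I →₀ B.B₁) →ₗ[B0 p] (I →₀ B0 p) :=
  Finsupp.mapRange.linearMap B.bd

/-- The inclusion of `Σ𝒜` in `ℬ₁`, applied to coefficients. -/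
noncomputable def susF (B : SecondaryAlgebra p) {I : Type} : (I →₀ Steenrod p) →+ (I →₀ B.B₁) :=
  Finsupp.mapRange.addMonoidHom B.sus

/-- The projection of `ℬ₁ = u(R_ℬ) ⊕ Σ𝒜` to `Σ𝒜`, applied to coefficients. -/
noncomputable def Splitting.sCompF (s : Splitting B) {I : Type} :
    (I →₀ B.B₁) →+ (I →₀ Steenrod p) :=
  Finsupp.mapRange.addMonoidHom s.sComp

theorem susF_apply {I : Type} (x : I →₀ Steenrod p) (i : I) : susF B x i = B.sus (x i) := rfl

theorem sCompF_apply (s : Splitting B) {I : Type} (x : I →₀ B.B₁) (i : I) :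
    s.sCompF x i = s.sComp (x i) := rfl

theorem bdF_susF {I : Type} (x : I →₀ Steenrod p) : bdF B (susF B x) = 0 :=
  Finsupp.ext fun i => B.bd_sus (x i)

theorem sCompF_susF (s : Splitting B) {I : Type} (x : I →₀ Steenrod p) :
    s.sCompF (susF B x) = x := Finsupp.ext fun i => s.sComp_sus (x i)

theorem ext_componentsF (s : Splitting B) {I : Type} {x y : I →₀ B.B₁} (h : bdF B x = bdF B y)
    (h' : s.sCompF x = s.sCompF y) : x = y :=
  Finsupp.ext fun i => s.ext_components (DFunLike.congr_fun h i) (DFunLike.congr_fun h' i)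

theorem exists_bdF_eq {I : Type} {x : I →₀ B0 p} (hx : toA x = 0) : ∃ y, bdF B y = x := by
  obtain ⟨y, -, h⟩ := exists_finsupp_lift B.bd.toAddMonoidHom (fun _ => ⊤) x fun i => by
    obtain ⟨y, hy⟩ := (B.exact₀ (x i)).1 (DFunLike.congr_fun hx i)
    exact ⟨y, trivial, hy⟩
  exact ⟨y, h⟩

theorem toA_bdF {I : Type} (y : I →₀ B.B₁) : toA (bdF B y) = 0 :=
  Finsupp.ext fun i => B.bd_mem_RB (y i)

theorem exists_susF_eq {I : Type} {x : I →₀ B.B₁} (hx : bdF B x = 0) : ∃ y, susF B y = x := by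
  obtain ⟨y, -, h⟩ := exists_finsupp_lift B.sus (fun _ => ⊤) x fun i => by
    obtain ⟨y, hy⟩ := (B.exact₁ (x i)).1 (DFunLike.congr_fun hx i)
    exact ⟨y, trivial, hy⟩
  exact ⟨y, h⟩

open Classical in
/-- The element with components `r ∈ R_ℬ⟨I⟩` and `a ∈ Σ𝒜⟨I⟩`. -/
noncomputable def Splitting.ofComponents (s : Splitting B) {I : Type} (r : I →₀ B0 p)
    (hr : ∀ i, r i ∈ RB p) (a : I →₀ Steenrod p) : I →₀ B.B₁ :=
  Finsupp.onFinset (r.support ∪ a.support) (fun i => s.u ⟨r i, hr i⟩ + B.sus (a i)) (by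
    intro i hi
    rw [Finset.mem_union, Finsupp.mem_support_iff, Finsupp.mem_support_iff]
    by_contra! h
    apply hi
    have h1 : (⟨r i, hr i⟩ : RB p) = 0 := Subtype.ext h.1
    rw [h1, h.2, map_zero, map_zero, add_zero])

theorem bdF_ofComponents (s : Splitting B) {I : Type} (r : I →₀ B0 p) (hr : ∀ i, r i ∈ RB p)
    (a : I →₀ Steenrod p) : bdF B (s.ofComponents r hr a) = r := by
  ext i
  change B.bd (s.u _ + B.sus _) = _
  rw [map_add, s.bd_u, B.bd_sus, add_zero]

theorem sCompF_ofComponents (s : Splitting B) {I : Type} (r : I →₀ B0 p) (hr : ∀ i, r i ∈ RB p)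
    (a : I →₀ Steenrod p) : s.sCompF (s.ofComponents r hr a) = a := by
  ext i
  change s.sComp (s.u _ + B.sus _) = _
  rw [map_add, s.sComp_u, s.sComp_sus, zero_add]

theorem ofComponents_mem (s : Splitting B) {I : Type} {r : I →₀ B0 p} (hr : ∀ i, r i ∈ RB p)
    {a : I →₀ Steenrod p} {deg : I → ℕ} {n : ℕ} (hr' : r ∈ freeGr (B0gr p) deg n)
    (ha : a ∈ freeGr (suspGr (Agr p)) deg n) : s.ofComponents r hr a ∈ freeGr B.gr deg n := by
  intro i
  change s.u ⟨r i, hr i⟩ + B.sus (a i) ∈ _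
  have h1 := hr' i
  have h2 := ha i
  unfold shiftGr at h1 h2 ⊢
  split_ifs at h1 h2 ⊢
  · exact add_mem (s.u_mem _ h1) (B.sus_mem_of_mem_suspGr h2)
  · rw [AddSubgroup.mem_bot] at h1 h2
    have h3 : (⟨r i, hr i⟩ : RB p) = 0 := Subtype.ext h1
    rw [h3, h2, map_zero, map_zero, add_zero]
    exact zero_mem _

end

/-! ### Homotopies and twisted maps -/

section
variable {p : ℕ} {B : SecondaryAlgebra p}

/-- On a free `ℬ`-module the identity `H∂ = dd` follows from `∂H = dd`. -/
theorem homotopy_bd {I : Type} {deg : I → ℕ} {N P : PairModule B.toPairAlgebra}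
    (f : (PairModule.free B.toPairAlgebra deg).Hom N) (g : N.Hom P)
    (H : (I →₀ B0 p) →ₗ[B0 p] P.M₁) (hH : ∀ x, P.bd (H x) = g.f₀ (f.f₀ x)) (y : I →₀ B.B₁) :
    H (bdF B y) = g.f₁ (f.f₁ y) := by
  induction y using Finsupp.induction_linear with
  | zero =>
    rw [map_zero, map_zero]
    exact (((congrArg g.f₁ (map_zero f.f₁)).trans (map_zero g.f₁))).symm
  | add x y hx hy =>
    rw [map_add, map_add, hx, hy]
    exact (((congrArg g.f₁ (map_add f.f₁ x y)).trans (map_add g.f₁ _ _))).symm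
  | single i b =>
    -- The element `b i` of the free module is `b` acting on the generator `i`.
    have h1 : (Finsupp.single i b : I →₀ B.B₁) =
        (PairModule.free B.toPairAlgebra deg).act b (Finsupp.single i 1 : I →₀ B0 p) := by
      change _ = Finsupp.mapRange.addMonoidHom (PairModule.mulRight b) (Finsupp.single i 1)
      simp [PairModule.mulRight]
    have h2 : bdF B (Finsupp.single i b) = B.bd b • (Finsupp.single i 1 : I →₀ B0 p) := by
      simp [bdF]
    rw [h2, map_smul, h1]
    refine Eq.trans ?_ (congrArg g.f₁ (f.f₁_act b _)).symm
    rw [g.f₁_act, ← P.act_bd, hH]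

variable [Fact p.Prime] {R : MinimalResolution p} (L : Lift R)

/-- The morphism `ℬ⟨g_{m+1}⟩ → ℬ⟨g_m⟩` given by the lifted matrix. -/
noncomputable def Lift.hom (L : Lift R) (B : SecondaryAlgebra p) (m : ℕ) :
    (PairModule.free B.toPairAlgebra (R.deg (m := m + 1))).Hom
      (PairModule.free B.toPairAlgebra (R.deg (m := m))) :=
  PairModule.freeLift _ _ L.D L.D_mem

/-- The map `ℬ₁⟨g_{m+1}⟩ → ℬ₁⟨g_m⟩` induced by the lifted matrix. -/
noncomputable def Lift.d₁ (L : Lift R) (B : SecondaryAlgebra p) (m : ℕ) :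
    (R.gen (m + 1) →₀ B.B₁) →ₗ[B0 p] (R.gen m →₀ B.B₁) :=
  (L.hom B m).f₁

theorem bdF_d₁ (m : ℕ) (x : R.gen (m + 1) →₀ B.B₁) : bdF B (L.d₁ B m x) = L.d m (bdF B x) :=
  (L.hom B m).bd_f₁ x

theorem d₁_single (m : ℕ) (g : R.gen (m + 1)) (x : B.B₁) (h : R.gen m) :
    L.d₁ B m (Finsupp.single g x) h = MulOpposite.op (L.D g h) • x := by
  have h1 := Finsupp.lsum_single ℕ
    (fun g => (PairModule.free B.toPairAlgebra (R.deg (m := m))).actOn (L.D g)) g x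
  exact DFunLike.congr_fun (F := R.gen m →₀ B.B₁) h1 h

/-- The projection to `Σ𝒜` is right `ℬ₀`-equivariant, so it commutes with the differentials, which
are given by matrices acting from the right. -/
theorem sCompF_d₁ (s : Splitting B) (m : ℕ) (x : R.gen (m + 1) →₀ B.B₁) :
    s.sCompF (L.d₁ B m x) = R.d m (s.sCompF x) := by
  induction x using Finsupp.induction_linear with
  | zero => simp
  | add x y hx hy => rw [map_add, map_add, hx, hy, map_add, map_add]
  | single g x =>
    ext h
    have h1 : s.sCompF (Finsupp.single g x) = Finsupp.single g (s.sComp x) := by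
      simp [Splitting.sCompF]
    rw [sCompF_apply, d₁_single, s.sComp_op_smul, h1, L.q_D, MinimalResolution.d,
      Finsupp.linearCombination_single]
    rfl

/-- The `Σ𝒜`-component of a homotopy `H` with `∂H = dd` depends only on the classes in `𝒜⟨g⟩` of
its arguments: on multiples `∂y` it is the component of `H∂y = ddy`, that is `dd = 0` in the
resolution. -/
theorem exists_twisted_of_homotopy (s : Splitting B)
    (H : ∀ m, (R.gen (m + 2) →₀ B0 p) →ₗ[B0 p] (R.gen m →₀ B.B₁))
    (hmem : ∀ {m k : ℕ} {x : R.gen (m + 2) →₀ B0 p}, x ∈ freeGr (B0gr p) R.deg k →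
      H m x ∈ freeGr B.gr R.deg k)
    (hbd : ∀ m x, bdF B (H m x) = L.d m (L.d (m + 1) x))
    (hH : ∀ m y, H m (bdF B y) = L.d₁ B m (L.d₁ B (m + 1) y)) :
    ∃ δ, IsTwisted s R L δ ∧ ∀ m x, s.sCompF (H m x) = δ m (toA x) := by
  have hker : ∀ m (x : R.gen (m + 2) →₀ B0 p), toA x = 0 → s.sCompF (H m x) = 0 := by
    intro m x hx
    obtain ⟨y, rfl⟩ := exists_bdF_eq (B := B) hx
    rw [hH, sCompF_d₁, sCompF_d₁, Lift.d_d]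
  have hex : ∀ m, ∃ ψ : (R.gen (m + 2) →₀ Steenrod p) →+ (R.gen m →₀ Steenrod p),
      ∀ x, ψ (toA x) = s.sCompF (H m x) := fun m =>
    exists_toA_factor (X := R.gen m →₀ Steenrod p) (s.sCompF.comp (H m).toAddMonoidHom) (hker m)
  choose δ hδ using hex
  refine ⟨δ, ⟨?_, ?_⟩, fun m x => (hδ m x).symm⟩
  · intro m k x hx
    obtain ⟨y, hy, rfl⟩ := exists_toA_eq_of_mem hx
    rw [hδ]
    exact freeGr_mapRange s.sComp (fun _ _ h => s.sComp_mem h) (hmem hy)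
  · intro m g n a ha h
    obtain ⟨b, hb, rfl⟩ := exists_q_eq_of_mem ha
    have h1 : (Finsupp.single g b : R.gen (m + 2) →₀ B0 p) = b • Finsupp.single g 1 := by simp
    have h2 : (Finsupp.single g 1 : R.gen (m + 2) →₀ Steenrod p) = toA (Finsupp.single g 1) := by
      rw [toA_single, map_one]
    rw [← toA_single, h2, hδ, hδ, h1, map_smul, sCompF_apply, sCompF_apply, Finsupp.smul_apply,
      s.sComp_smul hb]
    congr 2
    exact Subtype.ext (DFunLike.congr_fun (hbd m (Finsupp.single g 1)) h)

/-- Twisted families are determined by their values on generators. -/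
theorem IsTwisted.ext_gen {s : Splitting B}
    {δ δ' : ∀ m, (R.gen (m + 2) →₀ Steenrod p) →+ (R.gen m →₀ Steenrod p)}
    (hδ : IsTwisted s R L δ) (hδ' : IsTwisted s R L δ')
    (h : ∀ m g, δ m (Finsupp.single g 1) = δ' m (Finsupp.single g 1)) : δ = δ' := by
  funext m
  refine Finsupp.addHom_ext fun g a => ?_
  refine AddSubgroup.iSup_induction (Agr p)
    (C := fun a => δ m (Finsupp.single g a) = δ' m (Finsupp.single g a)) (mem_iSup_Agr a) ?_ ?_ ?_
  · intro n a ha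
    ext k
    rw [hδ.single m g ha, hδ'.single m g ha, h]
  · simp
  · intro x y hx hy
    rw [Finsupp.single_add, map_add, map_add, hx, hy]

theorem Lift.d_mem {m k : ℕ} {x : R.gen (m + 1) →₀ B0 p} (hx : x ∈ freeGr (B0gr p) R.deg k) :
    L.d m x ∈ freeGr (B0gr p) R.deg k :=
  linearCombination_mem (gr := freeGr (B0gr p) R.deg)
    (fun hb hy g => shiftGr_map (AddMonoidHom.mulLeft _) _ (fun _ _ hx => monGr_mul hb hx) _ _ _
      (hy g)) L.D_mem hx

/-- Arbitrary values of the `Σ𝒜`-components on the generators are realized by a homotopy. -/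
theorem exists_homotopy (s : Splitting B) (v : ∀ m, R.gen (m + 2) → (R.gen m →₀ Steenrod p))
    (hv : ∀ m g, v m g ∈ freeGr (suspGr (Agr p)) R.deg (R.deg g)) :
    ∃ (H : ∀ m, (R.gen (m + 2) →₀ B0 p) →ₗ[B0 p] (R.gen m →₀ B.B₁))
      (δ : ∀ m, (R.gen (m + 2) →₀ Steenrod p) →+ (R.gen m →₀ Steenrod p)),
      (∀ m k x, x ∈ freeGr (B0gr p) R.deg k → H m x ∈ freeGr B.gr R.deg k) ∧
      (∀ m x, bdF B (H m x) = L.d m (L.d (m + 1) x)) ∧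
      IsTwisted s R L δ ∧ (∀ m x, s.sCompF (H m x) = δ m (toA x)) ∧
      ∀ m g, δ m (Finsupp.single g 1) = v m g := by
  let H : ∀ m, (R.gen (m + 2) →₀ B0 p) →ₗ[B0 p] (R.gen m →₀ B.B₁) := fun m =>
    Finsupp.linearCombination (B0 p) fun g =>
      s.ofComponents _ (L.dd_mem m (Finsupp.single g 1)) (v m g)
  have hH : ∀ m g, H m (Finsupp.single g 1) =
      s.ofComponents _ (L.dd_mem m (Finsupp.single g 1)) (v m g) := by
    intro m g
    rw [Finsupp.linearCombination_single, one_smul]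
  have hmem : ∀ m k x, x ∈ freeGr (B0gr p) R.deg k → H m x ∈ freeGr B.gr R.deg k := by
    intro m k x hx
    refine linearCombination_mem (gr := freeGr B.gr R.deg) (fun {m n b y} hb hy g =>
      shiftGr_map (DistribSMul.toAddMonoidHom _ b) m (fun _ _ hx => B.smul_mem hb hx) _ _ _ (hy g))
      (fun g => ?_) hx
    exact ofComponents_mem s _ (L.d_mem (L.d_mem (single_one_mem _ g))) (hv m g)
  have hbd : ∀ m x, bdF B (H m x) = L.d m (L.d (m + 1) x) := by
    intro m x
    have h : (bdF B).comp (H m) = (L.d m).comp (L.d (m + 1)) := by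
      refine Finsupp.lhom_ext' fun g => LinearMap.ext_ring ?_
      exact (congrArg (bdF B) (hH m g)).trans (bdF_ofComponents s _ _ _)
    exact LinearMap.congr_fun h x
  obtain ⟨δ, h1, h2⟩ := exists_twisted_of_homotopy L s H (fun {m k x} hx => hmem m k x hx) hbd
    fun m y => homotopy_bd (L.hom B (m + 1)) (L.hom B m) (H m) (hbd m) y
  refine ⟨H, δ, hmem, hbd, h1, h2, fun m g => ?_⟩
  have h3 := h2 m (Finsupp.single g 1)
  rw [toA_single, map_one] at h3
  rw [← h3, hH, sCompF_ofComponents]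

theorem exists_homotopy_of_twisted {s : Splitting B}
    {δ : ∀ m, (R.gen (m + 2) →₀ Steenrod p) →+ (R.gen m →₀ Steenrod p)}
    (hδ : IsTwisted s R L δ) :
    ∃ H : ∀ m, (R.gen (m + 2) →₀ B0 p) →ₗ[B0 p] (R.gen m →₀ B.B₁),
      (∀ m k x, x ∈ freeGr (B0gr p) R.deg k → H m x ∈ freeGr B.gr R.deg k) ∧
      (∀ m x, bdF B (H m x) = L.d m (L.d (m + 1) x)) ∧
      ∀ m x, s.sCompF (H m x) = δ m (toA x) := by
  obtain ⟨H, δ', hmem, hbd, h1, h2, h3⟩ := exists_homotopy L s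
    (fun m g => δ m (Finsupp.single g 1)) fun m g => by
      have h := toA_mem (single_one_mem (p := p) R.deg g)
      rw [toA_single, map_one] at h
      exact hδ.mem h
  obtain rfl := h1.ext_gen L hδ h3
  exact ⟨H, hmem, hbd, h2⟩

/-- The relation `Hd = dH` may be tested on generators and on components. Both sides have the
boundary `ddd`, so only the `Σ𝒜`-components matter. -/
theorem homotopy_comm_of_gen {s : Splitting B}
    {δ : ∀ m, (R.gen (m + 2) →₀ Steenrod p) →+ (R.gen m →₀ Steenrod p)}
    {H : ∀ m, (R.gen (m + 2) →₀ B0 p) →ₗ[B0 p] (R.gen m →₀ B.B₁)}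
    (hbd : ∀ m x, bdF B (H m x) = L.d m (L.d (m + 1) x))
    (hs : ∀ m x, s.sCompF (H m x) = δ m (toA x)) {m : ℕ}
    (h : ∀ g : R.gen (m + 3),
      R.d m (δ (m + 1) (Finsupp.single g 1)) = δ m (R.d (m + 2) (Finsupp.single g 1)))
    (x : R.gen (m + 3) →₀ B0 p) : H m (L.d (m + 2) x) = L.d₁ B m (H (m + 1) x) := by
  have key : (H m).comp (L.d (m + 2)) = (L.d₁ B m).comp (H (m + 1)) := by
    refine Finsupp.lhom_ext' fun g => LinearMap.ext_ring (ext_componentsF s ?_ ?_)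
    · change bdF B (H m _) = bdF B (L.d₁ B m (H (m + 1) _))
      rw [hbd, bdF_d₁, hbd]
    · change s.sCompF (H m (L.d (m + 2) (Finsupp.single g 1))) =
        s.sCompF (L.d₁ B m (H (m + 1) (Finsupp.single g 1)))
      have hq : toA (L.d (m + 2) (Finsupp.single g 1)) =
          R.d (m + 2) (toA (Finsupp.single g 1)) := L.q_d _ _
      rw [hs, sCompF_d₁, hs, hq, toA_single, map_one, h]
  exact LinearMap.congr_fun key x

theorem twisted_comm_of_homotopy {s : Splitting B}
    {δ : ∀ m, (R.gen (m + 2) →₀ Steenrod p) →+ (R.gen m →₀ Steenrod p)}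
    {H : ∀ m, (R.gen (m + 2) →₀ B0 p) →ₗ[B0 p] (R.gen m →₀ B.B₁)}
    (hs : ∀ m x, s.sCompF (H m x) = δ m (toA x)) {m : ℕ}
    (h : ∀ x : R.gen (m + 3) →₀ B0 p, H m (L.d (m + 2) x) = L.d₁ B m (H (m + 1) x))
    (x : R.gen (m + 3) →₀ Steenrod p) : R.d m (δ (m + 1) x) = δ m (R.d (m + 2) x) := by
  obtain ⟨y, rfl⟩ := toA_surjective _ x
  have hq : toA (L.d (m + 2) y) = R.d (m + 2) (toA y) := L.q_d _ _
  rw [← hs, ← sCompF_d₁, ← h, hs, hq]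

theorem DeltaSystem.comm_apply {s : Splitting B} {L : Lift R} (Δ : DeltaSystem s R L) (m : ℕ)
    (x : R.gen (m + 3) →₀ Steenrod p) : R.d m (Δ.δ (m + 1) x) = Δ.δ m (R.d (m + 2) x) := by
  obtain ⟨H, -, hbd, hs⟩ := exists_homotopy_of_twisted L Δ.twisted
  exact twisted_comm_of_homotopy L hs (homotopy_comm_of_gen L hbd hs (Δ.comm m)) x

end

/-! ### Minimality and degrees -/

section
variable {p : ℕ} [Fact p.Prime]

theorem Agr_zero {a : Steenrod p} (ha : a ∈ Agr p 0) :
    a = algebraMap (ZMod p) (Steenrod p) (augA p a) := by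
  obtain ⟨b, hb, rfl⟩ := exists_q_eq_of_mem ha
  rw [augA_q, ← q_scalar, ← B0gr_zero hb]

theorem MinimalResolution.augA_d (R : MinimalResolution p) (m : ℕ)
    (x : R.gen (m + 1) →₀ Steenrod p) (h : R.gen m) : augA p (R.d m x h) = 0 := by
  induction x using Finsupp.induction_linear with
  | zero => simp
  | add x y hx hy => rw [map_add, Finsupp.add_apply, map_add, hx, hy, add_zero]
  | single g a =>
    rw [MinimalResolution.d, Finsupp.linearCombination_single, Finsupp.smul_apply, smul_eq_mul,
      map_mul, R.minimal, mul_zero]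

/-- In a minimal resolution the `m`-th generators have degree at least `m`: the differential of a
generator is nonzero, and its nonzero coefficients have positive degree. -/
theorem MinimalResolution.le_deg (R : MinimalResolution p) {m : ℕ} (g : R.gen m) : m ≤ R.deg g := by
  induction m with
  | zero => exact Nat.zero_le _
  | succ m ih =>
    obtain ⟨h, hh⟩ : ∃ h, R.D g h ≠ 0 := by
      by_contra! h0
      have h1 : Finsupp.linearCombination (Steenrod p) (R.D (m := m)) (Finsupp.single g 1) = 0 := by
        rw [Finsupp.linearCombination_single, one_smul]
        exact Finsupp.ext h0
      obtain ⟨y, hy⟩ := (R.exact_succ m _).1 h1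
      have h2 := R.augA_d (m + 1) y g
      rw [MinimalResolution.d, hy, Finsupp.single_eq_same, map_one] at h2
      exact one_ne_zero h2
    have h1 := R.D_mem g h
    have h2 := ih h
    unfold shiftGr at h1
    split_ifs at h1 with hle
    · by_contra! hlt
      have h3 : R.deg g - R.deg h = 0 := by omega
      rw [h3] at h1
      apply hh
      rw [Agr_zero h1, R.minimal, map_zero]
    · exact absurd (AddSubgroup.mem_bot.1 h1) hh

/-! ### Existence of completions -/

variable {B : SecondaryAlgebra p} (s : Splitting B) (R : MinimalResolution p)

/-- The morphism `ℬ⟨g₀⟩ → 𝔾^Σ` with `g₀ ↦ 1`. -/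
noncomputable def augHom :
    (PairModule.free B.toPairAlgebra (R.deg (m := 0))).Hom (GSigma s) :=
  PairModule.freeLift _ _ (fun _ => (1 : ZMod (p ^ 2))) (by
    intro g
    rw [R.gen_zero g, R.deg_g₀]
    trivial)

/-- The component `ℬ₀⟨g₀⟩ → 𝔾` of `augHom`. -/
noncomputable def augF₀ : (R.gen 0 →₀ B0 p) →ₗ[B0 p] (GSigma s).M₀ := (augHom s R).f₀

/-- The component `ℬ₁⟨g₀⟩ → 𝔽 ⊕ Σ𝔽` of `augHom`. -/
noncomputable def augF₁ : (R.gen 0 →₀ B.B₁) →ₗ[B0 p] (GSigma s).M₁ := (augHom s R).f₁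

variable {s R}

theorem bd_augF₁ (x : R.gen 0 →₀ B.B₁) :
    (GSigma s).bd (augF₁ s R x) = augF₀ s R (bdF B x) := (augHom s R).bd_f₁ x

theorem eq_single_g₀ {X : Type} [Zero X] (x : R.gen 0 →₀ X) : x = Finsupp.single R.g₀ (x R.g₀) := by
  ext g
  rw [R.gen_zero g, Finsupp.single_eq_same]

theorem augF₀_apply (x : R.gen 0 →₀ B0 p) :
    (show ZMod (p ^ 2) from augF₀ s R x) = augB p (x R.g₀) := by
  rw [eq_single_g₀ x, Finsupp.single_eq_same]
  refine Eq.trans (Finsupp.linearCombination_single (M := (GSigma s).M₀) (B0 p) _ R.g₀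
    (v := fun _ : R.gen 0 => (1 : ZMod (p ^ 2)))) ?_
  exact mul_one (augB p (x R.g₀))

theorem augF₁_apply (x : R.gen 0 →₀ B.B₁) :
    (show ZMod p × ZMod p from augF₁ s R x) = s.aug₁ (x R.g₀) := by
  rw [eq_single_g₀ x, Finsupp.single_eq_same]
  refine Eq.trans (Finsupp.lsum_single ℕ
    (fun _ : R.gen 0 => (GSigma s).actOn (1 : ZMod (p ^ 2))) R.g₀ _) ?_
  change ZMod.castHom (dvd_pow_self p two_ne_zero) (ZMod p) 1 • s.aug₁ (x R.g₀) = _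
  rw [map_one, one_smul]

theorem augF₁_susF (z : R.gen 0 →₀ Steenrod p) :
    (show ZMod p × ZMod p from augF₁ s R (susF B z)) = (0, augA p (z R.g₀)) := by
  refine (augF₁_apply _).trans (Prod.ext ?_ ?_)
  · have h : B.bdR (B.sus (z R.g₀)) = 0 := Subtype.ext (B.bd_sus _)
    rw [Splitting.aug₁_fst, susF_apply, h, map_zero]
  · rw [Splitting.aug₁_snd, susF_apply, s.sComp_sus]

theorem bd_bottom (L : Lift R) {η : (R.gen 1 →₀ B0 p) →ₗ[B0 p] (GSigma s).M₁}
    (hη : ∀ (k : ℕ) (x : R.gen 1 →₀ B0 p), x ∈ freeGr (B0gr p) R.deg k → η x ∈ (GSigma s).gr₁ k)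
    (x : R.gen 1 →₀ B0 p) : (GSigma s).bd (η x) = augF₀ s R (L.d 0 x) := by
  have h : (GSigma s).bd.comp η = (augF₀ s R).comp (L.d 0) := by
    refine Finsupp.lhom_ext' fun g => LinearMap.ext_ring ?_
    have hg := single_one_mem (p := p) R.deg g
    have h1 := (GSigma s).bd_mem (hη _ _ hg)
    have h2 := (augHom s R).f₀_mem (L.d_mem hg)
    -- Both sides lie in a positive degree of `𝔾`.
    obtain ⟨k, hk⟩ := Nat.exists_eq_add_of_le (R.le_deg g)
    rw [hk, Nat.add_comm 1 k] at h1 h2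
    exact (AddSubgroup.mem_bot.1 h1).trans (AddSubgroup.mem_bot.1 h2).symm
  exact LinearMap.congr_fun h x

theorem bottom_comm (L : Lift R) {η : (R.gen 1 →₀ B0 p) →ₗ[B0 p] (GSigma s).M₁}
    (hη : ∀ (k : ℕ) (x : R.gen 1 →₀ B0 p), x ∈ freeGr (B0gr p) R.deg k → η x ∈ (GSigma s).gr₁ k)
    {H : (R.gen 2 →₀ B0 p) →ₗ[B0 p] (R.gen 0 →₀ B.B₁)}
    (hH : ∀ k x, x ∈ freeGr (B0gr p) R.deg k → H x ∈ freeGr B.gr R.deg k)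
    (x : R.gen 2 →₀ B0 p) : η (L.d 1 x) = augF₁ s R (H x) := by
  have h : η.comp (L.d 1) = (augF₁ s R).comp H := by
    refine Finsupp.lhom_ext' fun g => LinearMap.ext_ring ?_
    have hg := single_one_mem (p := p) R.deg g
    have h1 := hη _ _ (L.d_mem hg)
    have h2 := (augHom s R).f₁_mem (hH _ _ hg)
    -- Both sides lie in a degree of `𝔽 ⊕ Σ𝔽` which is at least two.
    obtain ⟨k, hk⟩ := Nat.exists_eq_add_of_le (R.le_deg g)
    rw [hk, Nat.add_comm 2 k] at h1 h2
    exact (AddSubgroup.mem_bot.1 h1).trans (AddSubgroup.mem_bot.1 h2).symm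
  exact LinearMap.congr_fun h x

variable {L : Lift R}

theorem corresponds_iff {K : (liftComplex s R L).Completion} {Δ : DeltaSystem s R L} :
    Corresponds K Δ ↔ ∀ m x, s.sCompF (homotopy K m x) = Δ.δ m (toA x) := by
  have hbd : ∀ m x h, B.bdR (homotopy K m x h) = L.dd m x h := fun m x h =>
    Subtype.ext (DFunLike.congr_fun (F := R.gen m →₀ B0 p) (K.bd_H (m + 1) x) h)
  have key : ∀ m x h, homotopy K m x h = s.u (L.dd m x h) + B.sus (s.sComp (homotopy K m x h)) := by
    intro m x h
    rw [s.sus_sComp, hbd]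
    abel
  constructor
  · intro hK m x
    ext h
    rw [sCompF_apply, hK m x h, map_add, s.sComp_u, s.sComp_sus, zero_add]
  · intro hK m x h
    rw [key, ← sCompF_apply, hK]

theorem exists_completion {η : (R.gen 1 →₀ B0 p) →ₗ[B0 p] (GSigma s).M₁}
    (hη : ∀ (k : ℕ) (x : R.gen 1 →₀ B0 p), x ∈ freeGr (B0gr p) R.deg k → η x ∈ (GSigma s).gr₁ k)
    (Δ : DeltaSystem s R L) :
    ∃ K : (liftComplex s R L).Completion, bottom K = η ∧ Corresponds K Δ := by
  obtain ⟨H, hmem, hbd, hs⟩ := exists_homotopy_of_twisted L Δ.twisted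
  let K : (liftComplex s R L).Completion :=
    { H := fun
        | 0 => η
        | m + 1 => H m
      H_mem := fun {n k x} hx => by
        rcases n with _ | n
        · exact hη k x hx
        · exact hmem n k x hx
      bd_H := fun n x => by
        rcases n with _ | n
        · exact bd_bottom L hη x
        · exact hbd n x
      H_bd := fun n y => by
        rcases n with _ | n
        · exact homotopy_bd (L.hom B 0) (augHom s R) η (bd_bottom L hη) y
        · exact homotopy_bd (L.hom B (n + 1)) (L.hom B n) (H n) (hbd n) y
      H_d := fun n x => by
        rcases n with _ | n
        · exact bottom_comm L hη (hmem 0) x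
        · exact homotopy_comm_of_gen L hbd hs (Δ.comm n) x }
  exact ⟨K, rfl, corresponds_iff.2 hs⟩

theorem exists_deltaSystem (K : (liftComplex s R L).Completion) :
    ∃ Δ : DeltaSystem s R L, Corresponds K Δ := by
  let H : ∀ m, (R.gen (m + 2) →₀ B0 p) →ₗ[B0 p] (R.gen m →₀ B.B₁) := fun m => K.H (m + 1)
  obtain ⟨δ, hδ, hs⟩ := exists_twisted_of_homotopy L s H (fun hx => K.H_mem hx)
    (fun m x => K.bd_H (m + 1) x) fun m y => K.H_bd (m + 1) y
  exact ⟨⟨δ, hδ, fun m g => twisted_comm_of_homotopy L hs (fun x => K.H_d (m + 1) x) _⟩,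
    corresponds_iff.2 hs⟩

theorem Corresponds.deltaSystem_unique {K : (liftComplex s R L).Completion}
    {Δ Δ' : DeltaSystem s R L} (h : Corresponds K Δ) (h' : Corresponds K Δ') : Δ = Δ' := by
  rw [corresponds_iff] at h h'
  refine DeltaSystem.ext (funext fun m => AddMonoidHom.ext fun x => ?_)
  obtain ⟨y, rfl⟩ := toA_surjective _ x
  rw [← h, h']

theorem Corresponds.completion_unique {K K' : (liftComplex s R L).Completion}
    {Δ : DeltaSystem s R L} (hb : bottom K = bottom K') (h : Corresponds K Δ)
    (h' : Corresponds K' Δ) : K = K' := by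
  refine PreComplex.Completion.ext (funext fun n => ?_)
  rcases n with _ | m
  · exact hb
  · refine LinearMap.ext fun x => ?_
    refine Finsupp.ext (M := B.B₁) fun k => ?_
    exact (h m x k).trans (h' m x k).symm

/-! ### Exactness -/

theorem d₁_susF (s : Splitting B) (m : ℕ) (z : R.gen (m + 1) →₀ Steenrod p) :
    L.d₁ B m (susF B z) = susF B (R.d m z) := by
  refine ext_componentsF s ?_ ?_
  · rw [bdF_d₁, bdF_susF, bdF_susF, map_zero]
  · rw [sCompF_d₁, sCompF_susF, sCompF_susF]

theorem exists_eq_add_bdF (B : SecondaryAlgebra p) {m : ℕ} {c : R.gen m →₀ B0 p}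
    (h : ∃ y, R.d m y = toA c) :
    ∃ (b : R.gen (m + 1) →₀ B0 p) (β : R.gen m →₀ B.B₁), c = L.d m b + bdF B β := by
  obtain ⟨y, hy⟩ := h
  obtain ⟨b, rfl⟩ := toA_surjective _ y
  have hq : toA (L.d m b) = R.d m (toA b) := L.q_d _ _
  obtain ⟨β, hβ⟩ := exists_bdF_eq (B := B) (x := c - L.d m b) (by rw [map_sub, hq, hy, sub_self])
  exact ⟨b, β, by rw [hβ, add_sub_cancel]⟩

/-- The case of `exists_boundary` at the bottom: what is left of `γ` lies in `Σ𝔽` and is hit by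
`Σ𝒜` because `ε` is surjective. -/
theorem exists_boundary_bottom {η : (R.gen 1 →₀ B0 p) →ₗ[B0 p] (GSigma s).M₁}
    (hη : ∀ x, (GSigma s).bd (η x) = augF₀ s R (L.d 0 x)) {c : R.gen 0 →₀ B0 p}
    {γ : (GSigma s).M₁} (hc : augF₀ s R c = (GSigma s).bd γ) :
    ∃ (b : R.gen 1 →₀ B0 p) (β : R.gen 0 →₀ B.B₁),
      c = L.d 0 b + bdF B β ∧ γ = η b + augF₁ s R β := by
  have hc0 : augA p (toA c R.g₀) = 0 := by
    change augA p (q p (c R.g₀)) = 0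
    have h1 : augB p (c R.g₀) = incl p (show ZMod p × ZMod p from γ).1 :=
      (augF₀_apply c).symm.trans hc
    obtain ⟨k, hk⟩ := ZMod.intCast_surjective (show ZMod p × ZMod p from γ).1
    rw [augA_q, h1, ← hk, incl_intCast, map_mul, map_natCast, ZMod.natCast_self, mul_zero]
  obtain ⟨b, β, hb⟩ := exists_eq_add_bdF (L := L) B ((R.exact_zero _).1 hc0)
  have hγ : (GSigma s).bd (γ - η b - augF₁ s R β) = 0 := by
    rw [map_sub, map_sub, hη, bd_augF₁, ← hc, hb, map_add, add_sub_cancel_left, sub_self]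
  have hfst : (show ZMod p × ZMod p from γ - η b - augF₁ s R β).1 = 0 :=
    incl_injective p (Eq.trans hγ (map_zero (incl p)).symm)
  obtain ⟨z, hz⟩ : ∃ z : R.gen 0 →₀ Steenrod p, augF₁ s R (susF B z) = γ - η b - augF₁ s R β := by
    refine ⟨Finsupp.single R.g₀ (algebraMap (ZMod p) (Steenrod p)
      (show ZMod p × ZMod p from γ - η b - augF₁ s R β).2), (augF₁_susF _).trans ?_⟩
    rw [Finsupp.single_eq_same, AlgHom.commutes]
    exact Prod.ext hfst.symm rfl
  refine ⟨b, β + susF B z, ?_, ?_⟩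
  · rw [map_add, bdF_susF, add_zero, hb]
  · rw [map_add, hz]
    abel

/-- Correcting a secondary cycle by a secondary boundary: exactness of the resolution is applied
once to the class of `c` in `𝒜⟨g_{n+1}⟩`, and once to what is then left of `γ`, an element of
`Σ𝒜⟨g_n⟩`. The target `X` of `D` stands for `ℬ₁⟨g_{n-1}⟩` or, if `n = 0`, for `𝔽 ⊕ Σ𝔽`. -/
theorem exists_boundary (s : Splitting B) {X : Type} [AddCommGroup X] [Module (B0 p) X] {n : ℕ}
    {D : (R.gen n →₀ B.B₁) →ₗ[B0 p] X} {H : (R.gen (n + 1) →₀ B0 p) →ₗ[B0 p] X}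
    {H' : (R.gen (n + 2) →₀ B0 p) →ₗ[B0 p] (R.gen n →₀ B.B₁)}
    (hbd : ∀ x, bdF B (H' x) = L.d n (L.d (n + 1) x)) (hHd : ∀ x, H (L.d (n + 1) x) = D (H' x))
    (hHbd : ∀ y, H (bdF B y) = D (L.d₁ B n y))
    (hD : ∀ z, D (susF B z) = 0 → ∃ w, R.d n w = z)
    {c : R.gen (n + 1) →₀ B0 p} {γ : R.gen n →₀ B.B₁} (hc : L.d n c = bdF B γ)
    (hγ : H c = D γ) :
    ∃ (b : R.gen (n + 2) →₀ B0 p) (β : R.gen (n + 1) →₀ B.B₁),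
      c = L.d (n + 1) b + bdF B β ∧ γ = H' b + L.d₁ B n β := by
  have hq : toA (L.d n c) = R.d n (toA c) := L.q_d n c
  obtain ⟨b, β, hb⟩ := exists_eq_add_bdF (L := L) B ((R.exact_succ n (toA c)).1 (by
    rw [← MinimalResolution.d, ← hq, hc, toA_bdF]))
  obtain ⟨z, hz⟩ := exists_susF_eq (x := γ - H' b - L.d₁ B n β) (by
    rw [map_sub, map_sub, bdF_d₁, hbd, ← hc, hb, map_add, add_sub_cancel_left, sub_self])
  obtain ⟨w, rfl⟩ := hD z (by
    rw [hz, map_sub, map_sub, ← hγ, ← hHd, ← hHbd, hb, map_add, add_sub_cancel_left, sub_self])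
  refine ⟨b, β + susF B w, ?_, ?_⟩
  · rw [map_add, bdF_susF, add_zero, hb]
  · rw [map_add, d₁_susF s, hz]
    abel

theorem completion_exact (K : (liftComplex s R L).Completion) : K.Exact := by
  refine ⟨fun c => ?_, fun c γ hc => exists_boundary_bottom (K.bd_H 0) hc, fun n c γ hc hγ => ?_⟩
  · refine ⟨(Finsupp.single R.g₀ (algebraMap _ _ (show ZMod (p ^ 2) from c)) :
      R.gen 0 →₀ B0 p), 0, ?_⟩
    rw [map_zero, add_zero]
    refine Eq.symm ((augF₀_apply (s := s) _).trans ?_)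
    rw [Finsupp.single_eq_same]
    exact AlgHom.commutes _ _
  · rcases n with _ | n
    · refine exists_boundary s (D := augF₁ s R) (H := K.H 0) (H' := K.H 1) (K.bd_H 1) (K.H_d 0)
        (K.H_bd 0) (fun z hz => (R.exact_zero z).1 ?_) hc hγ
      exact congrArg Prod.snd ((augF₁_susF z).symm.trans hz)
    · refine exists_boundary s (D := L.d₁ B n) (H := K.H (n + 1)) (H' := K.H (n + 2))
        (K.bd_H (n + 2)) (K.H_d (n + 1)) (K.H_bd (n + 1)) (fun z hz => (R.exact_succ n z).1 ?_)
        hc hγ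
      rw [← MinimalResolution.d, ← sCompF_susF s (R.d n z), ← d₁_susF (L := L) s, hz, map_zero]

/-! ### The augmented resolution -/

theorem augAcyclic (R : MinimalResolution p) : AugAcyclic R := by
  refine ⟨fun x => ⟨(Finsupp.single R.g₀ (algebraMap (ZMod p) (Steenrod p) x) :
    R.gen 0 →₀ Steenrod p), ?_⟩, fun n x => ?_⟩
  · change augA p ((Finsupp.single R.g₀ (algebraMap (ZMod p) (Steenrod p) x)) R.g₀) = x
    rw [Finsupp.single_eq_same]
    exact AlgHom.commutes _ _
  · rcases n with _ | n
    · exact R.exact_zero x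
    · exact R.exact_succ n x

/-- Every chain map between acyclic complexes is a quasi-isomorphism. -/
theorem isQuasiIso_of_comm {f : ∀ n, Aug R (n + 2) →+ Aug R n}
    (hf : ∀ n x, augD R n (f (n + 1) x) = f n (augD R (n + 2) x)) : IsQuasiIso R f := by
  obtain ⟨h0, h1⟩ := augAcyclic R
  refine ⟨hf, h0, fun x hx => (h1 0 x).1 hx, fun x hx _ => (h1 1 x).1 hx,
    fun n x hx _ => (h1 (n + 2) x).1 hx, fun y => ?_, fun n y hy => ?_⟩
  · obtain ⟨z, hz⟩ := h0 (-y)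
    exact ⟨0, z, map_zero _, by rw [hz, map_zero, add_neg_cancel]⟩
  · obtain ⟨z, hz⟩ := (h1 n (-y)).1 (by rw [map_neg, hy, neg_zero])
    exact ⟨0, z, map_zero _, by rw [hz, map_zero, add_neg_cancel]⟩

/-- `δ̄` is a chain map. In the lowest degree both composites `𝒜⟨g₂⟩ → Σ𝔽` vanish: the elements of
`𝒜⟨g₂⟩` have degree at least two, and the coefficients of `d` are augmented to zero. -/
theorem deltaBar_comm (η : (R.gen 1 →₀ B0 p) →ₗ[B0 p] (GSigma s).M₁) (Δ : DeltaSystem s R L) (n : ℕ)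
    (x : Aug R (n + 3)) :
    augD R n (deltaBar η Δ (n + 1) x) = deltaBar η Δ n (augD R (n + 2) x) := by
  rcases n with _ | n
  · have hr : ∀ y : R.gen 2 →₀ Steenrod p,
        (show ZMod p from deltaBar η Δ 0 (R.d 1 y : R.gen 1 →₀ Steenrod p)) = 0 := by
      intro y
      change (R.d 1 y).sum (fun g a => augA p a *
        (show ZMod p × ZMod p from η (Finsupp.single g 1)).2) = 0
      exact Finset.sum_eq_zero fun g _ =>
        (congrArg (· * _) (R.augA_d 1 y g)).trans (zero_mul _)
    refine Eq.trans ?_ (hr x).symm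
    change augA p (Δ.δ 0 (show R.gen 2 →₀ Steenrod p from x) R.g₀) = 0
    induction (show R.gen 2 →₀ Steenrod p from x) using Finsupp.induction_linear with
    | zero => simp
    | add x y hx hy => rw [map_add, Finsupp.add_apply, map_add, hx, hy, add_zero]
    | single g a =>
      refine AddSubgroup.iSup_induction (Agr p)
        (C := fun a => augA p (Δ.δ 0 (Finsupp.single g a) R.g₀) = 0) (mem_iSup_Agr a) ?_ ?_ ?_
      · intro k a ha
        have h1 := Δ.twisted.mem (freeGr_single (deg := R.deg) ha g) R.g₀
        obtain ⟨l, hl⟩ := Nat.exists_eq_add_of_le (R.le_deg g)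
        have h2 : k + R.deg g = (k + l) + 2 + R.deg R.g₀ := by
          rw [R.deg_g₀, hl]
          omega
        rw [h2, shiftGr_of_le] at h1
        exact augA_eq_zero h1
      · simp
      · intro x y hx hy
        rw [Finsupp.single_add, map_add, Finsupp.add_apply, map_add, hx, hy, add_zero]
  · exact Δ.comm_apply n x

end

end SecondaryResolution

theorem theorem3p4 (p : ℕ) [Fact p.Prime] (B : SecondaryAlgebra p) (s : Splitting B)
    (R : MinimalResolution p) (L : Lift R)
    (η : (R.gen 1 →₀ B0 p) →ₗ[B0 p] (GSigma s).M₁)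
    (hη : ∀ (k : ℕ) (x : R.gen 1 →₀ B0 p), x ∈ freeGr (B0gr p) R.deg k → η x ∈ (GSigma s).gr₁ k) :
    (∃ Φ : {K : (liftComplex s R L).Completion // bottom K = η ∧ K.Exact} ≃ DeltaSystem s R L,
      ∀ K, Corresponds K.1 (Φ K)) ∧
    (∀ v : ∀ m, R.gen (m + 2) → (R.gen m →₀ Steenrod p),
      (∀ m g, v m g ∈ freeGr (suspGr (Agr p)) R.deg (R.deg g)) →
      ∃! δ : ∀ m, (R.gen (m + 2) →₀ Steenrod p) →+ (R.gen m →₀ Steenrod p),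
        IsTwisted s R L δ ∧ ∀ m g, δ m (Finsupp.single g 1) = v m g) ∧
    (∀ (Δ : DeltaSystem s R L) (m : ℕ) (x : R.gen (m + 3) →₀ Steenrod p),
      R.d m (Δ.δ (m + 1) x) = Δ.δ m (R.d (m + 2) x)) ∧
    AugAcyclic R ∧
    ∀ K : (liftComplex s R L).Completion, bottom K = η →
      K.Exact ∧ ∃! Δ : DeltaSystem s R L, Corresponds K Δ ∧
        (K.Exact ↔ IsQuasiIso R (deltaBar η Δ)) := by
  refine ⟨?_, fun v hv => ?_, fun Δ m x => Δ.comm_apply m x, augAcyclic R, fun K _ => ?_⟩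
  · choose φ hφ using fun K : (liftComplex s R L).Completion => exists_deltaSystem K
    refine ⟨Equiv.ofBijective (fun K => φ K.1) ⟨fun K K' h => Subtype.ext ?_, fun Δ => ?_⟩,
      fun K => hφ K.1⟩
    · have h' : φ K.1 = φ K'.1 := h
      exact (hφ K.1).completion_unique (K.2.1.trans K'.2.1.symm) (h' ▸ hφ K'.1)
    · obtain ⟨K, hb, hK⟩ := exists_completion hη Δ
      exact ⟨⟨K, hb, completion_exact K⟩, (hφ K).deltaSystem_unique hK⟩
  · obtain ⟨-, δ, -, -, hδ, -, hv'⟩ := exists_homotopy L s v hv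
    exact ⟨δ, ⟨hδ, hv'⟩, fun δ' h => h.1.ext_gen L hδ fun m g => (h.2 m g).trans (hv' m g).symm⟩
  · obtain ⟨Δ, hΔ⟩ := exists_deltaSystem K
    have hK := completion_exact K
    exact ⟨hK, Δ, ⟨hΔ, iff_of_true hK (isQuasiIso_of_comm (deltaBar_comm η Δ))⟩,
      fun Δ' h => h.1.deltaSystem_unique hΔ⟩
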